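/- **Setting.** Let $d\ge 2$, $t>0$, let $\alpha_3,\dots,\alpha_d$ be real numbers, and let $\hat\alpha_{n_1,\dots,n_s}$ be finitely many real numbers indexed by tuples $1\le n_1\le\dots\le n_s$, $s\ge1$. For a Hermitian $N\times N$ matrix $H$ let $D=\{H,\cdot\,\}$ act on $M_N(\mathbb C)$ and put $$\mathcal S(D)=\frac1{2t}\Big(\tfrac12\mathrm{Tr}\,D^2-\sum_{n=3}^d\tfrac{\alpha_n}{n}\mathrm{Tr}\,D^n\Big)-\sum_{s}\sum_{n_1\le\dots\le n_s}\Big(\frac Nt\Big)^{-4s}\hat\alpha_{n_1,\dots,n_s}\prod_{i=1}^s\mathrm{Tr}\,D^{n_i}.$$ With $P_\ell(H)=\mathrm{Tr}(H^\ell)/\ell$, expanding the traces gives $$\mathcal S(D)=\frac N{2t}\mathrm{Tr}\,H^2-\sum_{C}\frac{(N/t)^{2-2g-k}}{k!}\,\mathrm t^{(g)}_{\vec\ell}\,\prod_{i=1}^kP_{\ell_i}(H),$$ where $C=(g;\ell_1\le\dots\le\ell_k)$ runs over a finite set of types $\mathcal C$, as follows. The types with $g=0$ are $(0;\ell)$ for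 $3\le\ell\le d$, with Boltzmann weight $\mathrm t^{(0)}_\ell=\alpha_\ell$, and $(0;\ell_1,\ell_2)$ for $1\le\ell_1\le\ell_2$, $\ell_1+\ell_2\le d$. Put $n=\ell_1+\ell_2$ and $\alpha_2:=-1$. Then $\mathrm t^{(0)}_{\ell_1,\ell_2}=\epsilon\,\ell_1\ell_2\binom{n}{\ell_1}\frac{\alpha_n}{nt}$, with $\epsilon=1$ if $\ell_1=\ell_2$ and $\epsilon=2$ otherwise. In particular $\mathrm t^{(0)}_{1,1}=-1/t$. The remaining types come from the terms $\hat\alpha$ and have $g=s+1\ge2$. Let $\rho_0$ be the normalized Gaussian measure with density proportional to $e^{-\frac N{2t}\mathrm{Tr}H^2}$ on Hermitian matrices. Consider $Z_N=\rho_0[\Phi]$ and $W_1(x)=\sum_{\ell\ge0}x^{-\ell-1}Z_N^{-1}\rho_0[\Phi\,\mathrm{Tr}H^\ell]$, where $\Phi=\exp\big(\sum_C\frac{(N/t)^{2-2g-k}}{k!}\mathrm t^{(g)}_{\vec\ell}\prod_iP_{\ell_i}\big)$ is expanded as a formal power series in the Boltzmann weights, and the expansion is interchanged with $\rho_0$.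 Let $W_{0,1}=\sum_{\ell\ge0}Q_{0;\ell}\,x^{-\ell-1}$ be the leading coefficient of the large-$N$ expansion $W_1=\sum_{g\ge0}(N/t)^{1-2g}W_{g,1}$, i.e. the coefficientwise limit of $(N/t)^{-1}W_1$. Here $Q_{0;\ell}$ is a power series in $t$ whose coefficients are polynomials in the Boltzmann weights, and $Q_{0;0}=t$. Assume the following. The Boltzmann weights and $t$ are given the numerical values above, and each $Q_{0;\ell}$ then converges as a series in the powers of $t$. The series $W_{0,1}$ is the Laurent expansion at $\infty$ of a holomorphic function $W_{0,1}(x)$ on $\mathbb C\setminus[\mathfrak a,\mathfrak b]$, with $\mathfrak a<\mathfrak b$ real. The limits $\lim_{\epsilon\to0^+}W_{0,1}(s\pm\mathrm i\epsilon)$ exist for $s\in(\mathfrak a,\mathfrak b)$, and $$\varphi(s)=\frac1{2\pi\mathrm i}\lim_{\epsilon\to0^+}\big(W_{0,1}(s-\mathrm i\epsilon)-W_{0,1}(s+\mathrm i\epsilon)\big)>0\quad\text{on }(\mathfrak a,\mathfrak b),$$ with $\varphi:=0$ elsewhere. Let $\mu=\varphi(s)\,ds$ be the large-$N$ spectral distribution,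 and let $\mathfrak m_\ell=\int s^\ell\,d\mu(s)$ for $\ell\ge0$. **Proposition.** The measure $\mu$ is finite, and $W_{0,1}(x)=\int\frac{d\mu(s)}{x-s}$ for all $x\in\mathbb C\setminus[\mathfrak a,\mathfrak b]$. For all such $x$, $y=W_{0,1}(x)$ satisfies $$y^2+Q(x)\,y+P(x)=0,$$ where, with sums over $3\le\ell\le d$ and over $1\le\ell_1\le\ell_2$, $\ell_1+\ell_2\le d$, $$Q(x)=-x+\sum_{\ell}\mathrm t^{(0)}_\ell x^{\ell-1}+\frac12\sum_{\ell_1,\ell_2}\mathrm t^{(0)}_{\ell_1,\ell_2}\Big[\frac{\mathfrak m_{\ell_2}}{\ell_2}x^{\ell_1-1}+\frac{\mathfrak m_{\ell_1}}{\ell_1}x^{\ell_2-1}\Big],$$ $$P(x)=t-\sum_{\ell}\mathrm t^{(0)}_\ell\sum_{n=0}^{\ell-2}\mathfrak m_{\ell-2-n}x^n-\frac12\sum_{\ell_1,\ell_2}\mathrm t^{(0)}_{\ell_1,\ell_2}\Big[\frac{\mathfrak m_{\ell_2}}{\ell_2}\sum_{n=0}^{\ell_1-2}\mathfrak m_{\ell_1-2-n}x^n+\frac{\mathfrak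 m_{\ell_1}}{\ell_1}\sum_{n=0}^{\ell_2-2}\mathfrak m_{\ell_2-2-n}x^n\Big].$$ -/

import Mathlib

open scoped Topology

noncomputable section

namespace RandomGeometry

/-! ### Hermitian matrices, Dirac operators of type `(1,0)` -/

/-- The Hermitian matrix with real coordinates `x`: the diagonal entries are `x (i,i)`, and for
`i < j` the entry `H i j` has real part `x (i,j)` and imaginary part `x (j,i)`.  Lebesgue measure
on the coordinates is the measure `dH`. -/
def hermitianOf {N : ℕ} (x : Fin N × Fin N → ℝ) : Matrix (Fin N) (Fin N) ℂ :=
  fun i j =>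
    if i = j then (x (i, i) : ℂ)
    else if i < j then (x (i, j) : ℂ) + Complex.I * (x (j, i) : ℂ)
    else (x (j, i) : ℂ) - Complex.I * (x (i, j) : ℂ)

/-- `Tr (H ^ l)`; it is a real number for Hermitian `H`. -/
def trPow {N : ℕ} (H : Matrix (Fin N) (Fin N) ℂ) (l : ℕ) : ℝ := ((H ^ l).trace).re

/-- `P_l (H) = Tr (H ^ l) / l`. -/
def powerSum {N : ℕ} (H : Matrix (Fin N) (Fin N) ℂ) (l : ℕ) : ℝ := trPow H l / l

/-- The Dirac operator `D = {H, ·}` on `M_N(ℂ)`. -/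
def diracOp {N : ℕ} (H : Matrix (Fin N) (Fin N) ℂ) :
    Module.End ℂ (Matrix (Fin N) (Fin N) ℂ) :=
  LinearMap.mulLeft ℂ H + LinearMap.mulRight ℂ H

/-- `Tr (D ^ n)`, the trace of an operator on the `N²`-dimensional space `M_N(ℂ)`
(a real number for Hermitian `H`). -/
def trDirac {N : ℕ} (H : Matrix (Fin N) (Fin N) ℂ) (n : ℕ) : ℝ :=
  (LinearMap.trace ℂ (Matrix (Fin N) (Fin N) ℂ) (diracOp H ^ n)).re

/-- The parameters of the action functional: the degree `d` and the coupling constants `α n`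
(used for `3 ≤ n ≤ d`) of the unstable part, and the finitely many coupling constants
`αhat (n₁ ≤ ⋯ ≤ n_s)` of the stable part.  A multi-index `1 ≤ n₁ ≤ ⋯ ≤ n_s` is encoded as the
multiset `{n₁, …, n_s}`, and `s` is its cardinality. -/
structure Params where
  d : ℕ
  two_le_d : 2 ≤ d
  α : ℕ → ℝ
  αhat : Multiset ℕ →₀ ℝ
  αhat_supp : ∀ n ∈ αhat.support, n ≠ 0 ∧ ∀ i ∈ n, 1 ≤ i

/-- The Gaussian (free) action `S₀(H) = N/(2t) · Tr H²`. -/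
def freeAction {N : ℕ} (t : ℝ) (H : Matrix (Fin N) (Fin N) ℂ) : ℝ :=
  (N : ℝ) / (2 * t) * trPow H 2

/-- The action functional `S(D) = S_unstable(D) + S_stable(D)` of the Dirac operator `{H, ·}`. -/
def Params.action (M : Params) {N : ℕ} (t : ℝ) (H : Matrix (Fin N) (Fin N) ℂ) : ℝ :=
  1 / (2 * t) * (trDirac H 2 / 2 - ∑ n ∈ Finset.Icc 3 M.d, M.α n * (trDirac H n / n))
    + -∑ n ∈ M.αhat.support,
        ((N : ℝ) / t) ^ (-4 * (n.card : ℤ)) * (M.αhat n * (n.map (trDirac H)).prod)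

/-! ### Elementary 2-cells and Boltzmann weights -/

/-- An elementary 2-cell: the genus and the multiset of perimeters of the polygonal boundaries. -/
abbrev Cell := ℕ × Multiset ℕ

/-- Euler characteristic `2 - 2g - β₀(∂C)`. -/
def eulerChar (C : Cell) : ℤ := 2 - 2 * (C.1 : ℤ) - (C.2.card : ℤ)

/-- `Tr (D ^ n)` as a polynomial in the variables `X k = Tr (H ^ k)`, `k ≥ 0` (`X 0 = N`). -/
def diracPoly (n : ℕ) : MvPolynomial ℕ ℝ :=
  ∑ k ∈ Finset.range (n + 1),
    MvPolynomial.C (n.choose k : ℝ) * (MvPolynomial.X k * MvPolynomial.X (n - k))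

/-- The perimeters occurring in a monomial in the variables `X k`: the variable `X 0 = N` is
discarded. -/
def perimeters (m : ℕ →₀ ℕ) : Multiset ℕ := (Finsupp.toMultiset m).filter (· ≠ 0)

/-- The index set of pairs `1 ≤ l₁ ≤ l₂` with `2 ≤ l₁ + l₂ ≤ d`. -/
def cylinderIndex (d : ℕ) : Finset (ℕ × ℕ) :=
  (Finset.Icc 1 d ×ˢ Finset.Icc 1 d).filter fun l => l.1 ≤ l.2 ∧ l.1 + l.2 ≤ d

/-- Planar cells with one boundary. -/
def diskCells (d : ℕ) : Finset Cell := (Finset.Icc 3 d).image fun l => (0, {l})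

/-- Planar cells with two boundaries. -/
def cylinderCells (d : ℕ) : Finset Cell :=
  (cylinderIndex d).image fun l => (0, {l.1, l.2})

/-- The polynomial in the `X k = Tr (H ^ k)` that expresses `∏ᵢ Tr (D ^ nᵢ)`. -/
def diracProdPoly (n : Multiset ℕ) : MvPolynomial ℕ ℝ := (n.map diracPoly).prod

/-- Stable cells: genus `s + 1`, and perimeters from the expansion of `∏_{i ≤ s} Tr (D ^ nᵢ)`. -/
def Params.stableCells (M : Params) : Finset Cell :=
  M.αhat.support.biUnion fun n =>
    (diracProdPoly n).support.image fun m => (n.card + 1, perimeters m)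

/-- The finite set of all elementary 2-cells of the model. -/
def Params.cells (M : Params) : Finset Cell :=
  (diskCells M.d ∪ cylinderCells M.d) ∪ M.stableCells

/-- `α n` for `n ≥ 3`, completed by `-1` for the quadratic term. -/
def Params.αext (M : Params) (n : ℕ) : ℝ := if n = 2 then -1 else M.α n

/-- The Boltzmann weight of the disk `(0; l)`. -/
def Params.diskWeight (M : Params) (l : ℕ) : ℝ := M.α l

/-- The Boltzmann weight of a cylinder `(0; l₁, l₂)`, collecting all the terms
`α n / (n t) · (n choose r) · Tr (H ^ (n-r)) · Tr (H ^ r)`, `1 ≤ r ≤ n - 1`, with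
`{r, n - r} = {l₁, l₂}`; here `n = l₁ + l₂`. -/
def Params.cylinderWeight (M : Params) (t : ℝ) (L : Multiset ℕ) : ℝ :=
  (L.prod : ℝ) * (M.αext L.sum / (L.sum * t)) *
    ∑ r ∈ Finset.Icc 1 (L.sum - 1),
      if ({r, L.sum - r} : Multiset ℕ) = L then (L.sum.choose r : ℝ) else 0

/-- The Boltzmann weight of a stable cell, collecting all the terms of the expansion of the
products `αhat n · ∏ᵢ Tr (D ^ nᵢ)` that are carried by this cell. -/
def Params.stableWeight (M : Params) (t : ℝ) (C : Cell) : ℝ :=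
  (C.2.card.factorial : ℝ) * (C.2.prod : ℝ) *
    ∑ n ∈ M.αhat.support, ∑ m ∈ (diracProdPoly n).support,
      if (n.card + 1, perimeters m) = C then
        t ^ (m 0) * (M.αhat n * (diracProdPoly n).coeff m) else 0

/-- The Boltzmann weight of an elementary 2-cell. -/
def Params.weight (M : Params) (t : ℝ) (C : Cell) : ℝ :=
  if C.1 = 0 then
    if C.2.card = 1 then M.diskWeight C.2.sum else M.cylinderWeight t C.2
  else M.stableWeight t C

/-- The contribution `(N/t)^χ / β₀(∂C)! · ∏ᵢ P_{lᵢ}(H)` of a cell, without its Boltzmann weight. -/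
def cellTerm {N : ℕ} (t : ℝ) (H : Matrix (Fin N) (Fin N) ℂ) (C : Cell) : ℝ :=
  ((N : ℝ) / t) ^ eulerChar C / (C.2.card.factorial : ℝ) * (C.2.map (powerSum H)).prod

/-- The interaction part of the action. -/
def Params.intAction (M : Params) {N : ℕ} (t : ℝ) (H : Matrix (Fin N) (Fin N) ℂ) : ℝ :=
  -∑ C ∈ M.cells, M.weight t C * cellTerm t H C

/-! ### The action functional in terms of the elementary 2-cells -/

section Decomposition

open Finset

lemma trace_lr {N : ℕ} (A B : Matrix (Fin N) (Fin N) ℂ) :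
    LinearMap.trace ℂ (Matrix (Fin N) (Fin N) ℂ) (LinearMap.mulLeft ℂ A * LinearMap.mulRight ℂ B)
      = A.trace * B.trace := by
  classical
  rw [LinearMap.trace_eq_matrix_trace ℂ (Matrix.stdBasis ℂ (Fin N) (Fin N))]
  simp only [Matrix.trace, Matrix.diag, LinearMap.toMatrix_apply]
  rw [Fintype.sum_prod_type, Finset.sum_mul_sum]
  refine Finset.sum_congr rfl fun i _ => Finset.sum_congr rfl fun j _ => ?_
  rw [Matrix.stdBasis_eq_single]
  have h : (LinearMap.mulLeft ℂ A * LinearMap.mulRight ℂ B) (Matrix.single i j (1 : ℂ)) i j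
      = A i i * B j j := by
    simp only [Module.End.mul_apply, LinearMap.mulLeft_apply, LinearMap.mulRight_apply]
    rw [← mul_assoc, Matrix.mul_apply, Finset.sum_eq_single j]
    · simp
    · intro k _ hk
      simp [Matrix.mul_single_apply_of_ne, hk]
    · simp
  rw [← h]
  rfl

lemma trace_real {N : ℕ} {H : Matrix (Fin N) (Fin N) ℂ} (hH : H.IsHermitian) (l : ℕ) :
    (H ^ l).trace = (trPow H l : ℂ) := by
  have h : (starRingEnd ℂ) (H ^ l).trace = (H ^ l).trace := by
    have := Matrix.trace_conjTranspose (H ^ l)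
    rw [(hH.pow l).eq] at this
    exact this.symm
  exact (Complex.conj_eq_iff_re.mp h).symm

lemma trDirac_eq {N : ℕ} {H : Matrix (Fin N) (Fin N) ℂ} (hH : H.IsHermitian) (n : ℕ) :
    trDirac H n = ∑ k ∈ range (n + 1), (n.choose k : ℝ) * (trPow H k * trPow H (n - k)) := by
  have : LinearMap.trace ℂ (Matrix (Fin N) (Fin N) ℂ) (diracOp H ^ n)
      = ((∑ k ∈ range (n + 1), (n.choose k : ℝ) * (trPow H k * trPow H (n - k)) : ℝ) : ℂ) := by
    rw [diracOp, (LinearMap.commute_mulLeft_right H H).add_pow, map_sum]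
    push_cast
    refine Finset.sum_congr rfl fun k _ => ?_
    rw [LinearMap.pow_mulLeft, LinearMap.pow_mulRight, ← nsmul_eq_mul', map_nsmul, trace_lr,
      trace_real hH, trace_real hH, nsmul_eq_mul]
  rw [trDirac, this, Complex.ofReal_re]

lemma hermitianOf_isHermitian {N : ℕ} (x : Fin N × Fin N → ℝ) : (hermitianOf x).IsHermitian := by
  ext i j
  rw [Matrix.conjTranspose_apply]
  unfold hermitianOf
  rcases lt_trichotomy i j with h | h | h
  · simp [h, h.ne, h.ne', h.not_gt]
  · subst h; simp
  · simp [h, h.ne, h.ne', h.not_gt, sub_eq_add_neg]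

lemma trDirac_eq_eval {N : ℕ} {H : Matrix (Fin N) (Fin N) ℂ} (hH : H.IsHermitian) (n : ℕ) :
    trDirac H n = MvPolynomial.eval (trPow H) (diracPoly n) := by
  simp [trDirac_eq hH, diracPoly]

lemma diracPoly_hom (n : ℕ) : (diracPoly n).IsHomogeneous 2 := by
  refine MvPolynomial.IsHomogeneous.sum _ _ _ fun k _ => ?_
  exact (MvPolynomial.isHomogeneous_C ℕ _).mul
    ((MvPolynomial.isHomogeneous_X ℝ k).mul (MvPolynomial.isHomogeneous_X ℝ (n - k)))

lemma diracProdPoly_hom (n : Multiset ℕ) : (diracProdPoly n).IsHomogeneous (2 * n.card) := by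
  induction n using Multiset.induction with
  | empty => simpa [diracProdPoly] using MvPolynomial.isHomogeneous_one ℕ ℝ
  | cons a s ih =>
    have := (diracPoly_hom a).mul ih
    simp only [diracProdPoly, Multiset.map_cons, Multiset.prod_cons, Multiset.card_cons] at this ⊢
    convert this using 1; ring

lemma prod_powerSum {N : ℕ} (H : Matrix (Fin N) (Fin N) ℂ) (L : Multiset ℕ) (hL : 0 ∉ L) :
    (L.prod : ℝ) * (L.map (powerSum H)).prod = (L.map (trPow H)).prod := by
  induction L using Multiset.induction with
  | empty => simp
  | cons a s ih =>
    simp only [Multiset.mem_cons, not_or] at hL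
    have ha : (a : ℝ) ≠ 0 := Nat.cast_ne_zero.mpr (Ne.symm hL.1)
    simp only [Multiset.prod_cons, Multiset.map_cons, Nat.cast_mul, ← ih hL.2, powerSum]
    field_simp

lemma trPow_zero {N : ℕ} (H : Matrix (Fin N) (Fin N) ℂ) : trPow H 0 = N := by simp [trPow]

lemma filter_zero (m : ℕ →₀ ℕ) :
    (Finsupp.toMultiset m).filter (fun a => ¬ a ≠ 0) = Multiset.replicate (m 0) 0 := by
  have : (fun a : ℕ => ¬ a ≠ 0) = fun a => a = 0 := by ext; simp
  simp only [this, Multiset.filter_eq', Finsupp.count_toMultiset]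

lemma monomial_eq {N : ℕ} (H : Matrix (Fin N) (Fin N) ℂ) (m : ℕ →₀ ℕ) :
    (m.prod fun i n => trPow H i ^ n) = (N : ℝ) ^ m 0 * ((perimeters m).map (trPow H)).prod := by
  have h1 : (m.prod fun i n => trPow H i ^ n) = ((Finsupp.toMultiset m).map (trPow H)).prod := by
    rw [Finsupp.toMultiset_map, Finsupp.prod_toMultiset, Finsupp.prod_mapDomain_index] <;>
      simp [pow_add]
  rw [h1, ← Multiset.filter_add_not (fun a => a ≠ 0) (Finsupp.toMultiset m), filter_zero,
    Multiset.map_add, Multiset.prod_add, perimeters]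
  simp [trPow_zero, mul_comm]

lemma card_perimeters (m : ℕ →₀ ℕ) : m.degree = m 0 + (perimeters m).card := by
  have := Multiset.filter_add_not (fun a => a ≠ 0) (Finsupp.toMultiset m)
  rw [filter_zero] at this
  have := congrArg Multiset.card this
  rw [Multiset.card_add, Multiset.card_replicate, Finsupp.card_toMultiset] at this
  rw [perimeters, add_comm, this]
  rfl

lemma stable_sum (M : Params) {N : ℕ} {H : Matrix (Fin N) (Fin N) ℂ} (hH : H.IsHermitian)
    {t : ℝ} (ht : t ≠ 0) (hN : N ≠ 0) :
    ∑ C ∈ M.stableCells, M.stableWeight t C * cellTerm t H C =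
      ∑ n ∈ M.αhat.support,
        ((N : ℝ) / t) ^ (-4 * (n.card : ℤ)) * (M.αhat n * (n.map (trDirac H)).prod) := by
  have hN' : (N : ℝ) ≠ 0 := by exact_mod_cast hN
  simp only [Params.stableWeight, Finset.sum_mul, Finset.mul_sum]
  rw [Finset.sum_comm]
  refine Finset.sum_congr rfl fun n hn => ?_
  have he : (n.map (trDirac H)).prod = MvPolynomial.eval (trPow H) (diracProdPoly n) := by
    rw [diracProdPoly, map_multiset_prod, Multiset.map_map]
    congr 1
    exact Multiset.map_congr rfl fun a _ => trDirac_eq_eval hH a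
  rw [he, MvPolynomial.eval_eq, Finset.mul_sum, Finset.mul_sum, Finset.sum_comm]
  refine Finset.sum_congr rfl fun m hm => ?_
  have hmem : (n.card + 1, perimeters m) ∈ M.stableCells := by
    simp only [Params.stableCells, mem_biUnion, mem_image]
    exact ⟨n, hn, m, hm, rfl⟩
  rw [Finset.sum_eq_single_of_mem _ hmem]
  swap
  · intro C _ hC; simp [hC.symm]
  have hdeg : m 0 + (perimeters m).card = 2 * n.card := by
    rw [← card_perimeters]
    by_contra h
    exact (MvPolynomial.mem_support_iff.mp hm) ((diracProdPoly_hom n).coeff_eq_zero h)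
  have hp := monomial_eq H m
  have h0 : 0 ∉ perimeters m := by simp [perimeters]
  rw [← prod_powerSum H _ h0] at hp
  have hpr : (∏ i ∈ m.support, trPow H i ^ m i) = m.prod fun i n => trPow H i ^ n := rfl
  have hchi : eulerChar (n.card + 1, perimeters m) = -4 * (n.card : ℤ) + (m 0 : ℕ) := by
    simp only [eulerChar]; push_cast; omega
  have hf : ((perimeters m).card.factorial : ℝ) ≠ 0 := by positivity
  rw [if_pos rfl, hpr, hp, cellTerm, hchi, zpow_add₀ (div_ne_zero hN' ht), zpow_natCast, div_pow]
  field_simp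

lemma disk_sum (M : Params) {N : ℕ} (H : Matrix (Fin N) (Fin N) ℂ) (t : ℝ) :
    ∑ C ∈ diskCells M.d, M.weight t C * cellTerm t H C =
      ∑ l ∈ Icc 3 M.d, (N : ℝ) / t * (M.α l * (trPow H l / l)) := by
  rw [diskCells, Finset.sum_image]
  · refine Finset.sum_congr rfl fun l _ => ?_
    simp [Params.weight, Params.diskWeight, cellTerm, eulerChar, powerSum]
    ring
  · intro a _ b _ h
    simpa using h

lemma cylinder_sum (M : Params) {N : ℕ} (H : Matrix (Fin N) (Fin N) ℂ) (t : ℝ) :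
    ∑ C ∈ cylinderCells M.d, M.weight t C * cellTerm t H C =
      ∑ n ∈ Icc 2 M.d, ∑ r ∈ Icc 1 (n - 1),
        1 / 2 * (M.αext n / (n * t)) * (n.choose r * (trPow H r * trPow H (n - r))) := by
  have key : ∀ C ∈ cylinderCells M.d, M.weight t C * cellTerm t H C =
      ∑ n ∈ Icc 2 M.d, ∑ r ∈ Icc 1 (n - 1), if ((0, {r, n - r}) : Cell) = C then
        1 / 2 * (M.αext n / (n * t)) * (n.choose r * (trPow H r * trPow H (n - r))) else 0 := by
    intro C hC
    simp only [cylinderCells, cylinderIndex, mem_image, mem_filter, mem_product, mem_Icc,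
      Prod.exists] at hC
    obtain ⟨a, b, ⟨⟨⟨ha, _⟩, hb, _⟩, hab, hd⟩, rfl⟩ := hC
    rw [Finset.sum_eq_single_of_mem (a + b) (by simp; omega)]
    · have hc : (({a, b} : Multiset ℕ)).card = 2 := by simp
      have hs : (({a, b} : Multiset ℕ)).sum = a + b := by simp
      have h0 : (0 : ℕ) ∉ ({a, b} : Multiset ℕ) := by simp; omega
      have hp := prod_powerSum H _ h0
      simp only [Params.weight, hc, Params.cylinderWeight, hs, cellTerm, eulerChar]
      norm_num only [if_true, if_false, zpow_zero, Nat.factorial]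
      rw [show ∀ x y z w : ℝ, x * y * z * (1 / 2 * w) = (x * w) * (1 / 2 * y) * z by
        intros; ring]
      rw [hp, Finset.mul_sum]
      refine Finset.sum_congr rfl fun r hr => ?_
      by_cases h : ({r, a + b - r} : Multiset ℕ) = {a, b}
      · rw [if_pos h, if_pos (by rw [h]), ← h]
        simp
        ring
      · rw [if_neg h, if_neg (by simpa using h)]; simp
    · intro n hn hne
      refine Finset.sum_eq_zero fun r hr => if_neg fun h => hne ?_
      have := congrArg Multiset.sum (Prod.ext_iff.mp h).2
      simp at this hr hn
      omega
  rw [Finset.sum_congr rfl key, Finset.sum_comm]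
  refine Finset.sum_congr rfl fun n hn => ?_
  rw [Finset.sum_comm]
  refine Finset.sum_congr rfl fun r hr => ?_
  rw [Finset.sum_ite_eq, if_pos]
  simp only [mem_Icc] at hn hr
  simp only [cylinderCells, cylinderIndex, mem_image, mem_filter, mem_product, mem_Icc,
      Prod.exists]
  rcases le_total r (n - r) with h | h
  · exact ⟨r, n - r, by omega, rfl⟩
  · exact ⟨n - r, r, by omega, by rw [Multiset.pair_comm]⟩

lemma trDirac_split {N : ℕ} {H : Matrix (Fin N) (Fin N) ℂ} (hH : H.IsHermitian) {n : ℕ}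
    (hn : 1 ≤ n) : trDirac H n = 2 * N * trPow H n +
      ∑ r ∈ Icc 1 (n - 1), (n.choose r : ℝ) * (trPow H r * trPow H (n - r)) := by
  obtain ⟨n, rfl⟩ := Nat.exists_eq_add_of_le' hn
  rw [trDirac_eq hH, Finset.sum_range_succ, Finset.range_eq_Ico,
    Finset.sum_eq_sum_Ico_succ_bot (by omega), trPow_zero]
  have : Icc 1 (n + 1 - 1) = Ico (0 + 1) (n + 1) := by ext; simp
  rw [this]
  simp [trPow_zero]
  ring

/-- The decomposition `S(D) = S₀(H) + S_int(H)` of the action functional: the Boltzmann weights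
defined above are those of the model. -/
theorem action_eq (M : Params) {N : ℕ} (hN : N ≠ 0) {t : ℝ} (ht : t ≠ 0)
    {H : Matrix (Fin N) (Fin N) ℂ} (hH : H.IsHermitian) :
    M.action t H = freeAction t H + M.intAction t H := by
  have d1 : Disjoint (diskCells M.d) (cylinderCells M.d) := by
    rw [Finset.disjoint_left]
    intro C h1 h2
    simp only [diskCells, cylinderCells, mem_image] at h1 h2
    obtain ⟨l, _, rfl⟩ := h1
    obtain ⟨p, _, hp⟩ := h2
    have := congrArg Multiset.card (Prod.ext_iff.mp hp).2
    simp at this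
  have hst : ∀ C ∈ M.stableCells, C.1 ≠ 0 := by
    intro C hC
    simp only [Params.stableCells, mem_biUnion, mem_image] at hC
    obtain ⟨n, _, m, _, rfl⟩ := hC
    simp
  have d2 : Disjoint (diskCells M.d ∪ cylinderCells M.d) M.stableCells := by
    rw [Finset.disjoint_left]
    intro C h1 h2
    refine hst C h2 ?_
    simp only [diskCells, cylinderCells, mem_union, mem_image] at h1
    rcases h1 with ⟨l, _, rfl⟩ | ⟨l, _, rfl⟩ <;> rfl
  have hs : ∑ C ∈ M.stableCells, M.weight t C * cellTerm t H C =
      ∑ C ∈ M.stableCells, M.stableWeight t C * cellTerm t H C :=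
    Finset.sum_congr rfl fun C hC => by rw [Params.weight, if_neg (hst C hC)]
  rw [Params.intAction, Params.cells, Finset.sum_union d2, Finset.sum_union d1, hs,
    stable_sum M hH ht hN, disk_sum, cylinder_sum, Params.action, freeAction,
    trDirac_split hH (by norm_num : 1 ≤ 2)]
  have hI : Icc 2 M.d = insert 2 (Icc 3 M.d) := by
    have := M.two_le_d
    ext; simp; omega
  have h3 : ∀ n ∈ Icc 3 M.d, M.α n * (trDirac H n / n) = 2 * t *
      (N / t * (M.α n * (trPow H n / n)) + ∑ r ∈ Icc 1 (n - 1), 1 / 2 * (M.αext n / (n * t)) *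
        (n.choose r * (trPow H r * trPow H (n - r)))) := by
    intro n hn
    have hn3 : 3 ≤ n := (mem_Icc.mp hn).1
    have hn0 : (n : ℝ) ≠ 0 := by positivity
    rw [trDirac_split hH (by omega), ← Finset.mul_sum, Params.αext, if_neg (by omega)]
    field_simp
  rw [Finset.sum_congr rfl h3, hI, Finset.sum_insert (by simp), ← Finset.mul_sum,
    Finset.sum_add_distrib]
  have h2 : Icc 1 (2 - 1) = {1} := rfl
  simp only [h2, Finset.sum_singleton, Params.αext, if_true]
  norm_num
  field_simp
  ring

end Decomposition


/-! ### The formal matrix integral -/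

/-- The Gaussian expectation `ρ₀[f] = c ∫ f(H) exp (-S₀(H)) dH` over `N × N` Hermitian matrices. -/
def gaussianMean (N : ℕ) (t : ℝ) (f : Matrix (Fin N) (Fin N) ℂ → ℝ) : ℝ :=
  (Real.sqrt (2 ^ N * (Real.pi * t / N) ^ (N ^ 2)))⁻¹ *
    ∫ x : Fin N × Fin N → ℝ, f (hermitianOf x) * Real.exp (-freeAction t (hermitianOf x))

/-- The coefficient of the monomial `∏_C t_C ^ k_C` in the expansion of
`Φ(H) = exp (∑_C t_C · cellTerm C)` as a formal power series in the Boltzmann weights `t_C`. -/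
def Params.phiCoeff (M : Params) {N : ℕ} (t : ℝ) (H : Matrix (Fin N) (Fin N) ℂ)
    (k : M.cells →₀ ℕ) : ℝ :=
  ∏ C : M.cells, cellTerm t H C.1 ^ k C / ((k C).factorial : ℝ)

/-- `ρ₀[f Φ]`, expanded in the Boltzmann weights with sum and integral interchanged. -/
def Params.formalMean (M : Params) (N : ℕ) (t : ℝ) (f : Matrix (Fin N) (Fin N) ℂ → ℝ) :
    MvPowerSeries M.cells ℝ :=
  fun k => gaussianMean N t fun H => f H * M.phiCoeff t H k

/-- The formal partition function `Z_N = ρ₀[Φ]`. -/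
def Params.partitionFunction (M : Params) (N : ℕ) (t : ℝ) : MvPowerSeries M.cells ℝ :=
  M.formalMean N t fun _ => 1

/-- The coefficient of `x ^ (-(l+1))` in the formal one-point correlator
`W₁(x) = ∑_l x ^ (-(l+1)) · Z_N⁻¹ ρ₀[Φ(H) Tr (H ^ l)]`. -/
def Params.correlator (M : Params) (N : ℕ) (t : ℝ) (l : ℕ) : MvPowerSeries M.cells ℝ :=
  M.formalMean N t (fun H => trPow H l) * (M.partitionFunction N t)⁻¹

/-- The leading order `W_{0,1}` of the large-`N` expansion `W₁ = ∑_g (N/t)^(1-2g) W_{g,1}`: the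
coefficient of `x ^ (-(l+1))` and of the monomial `k` in the Boltzmann weights. -/
def Params.planarCoeff (M : Params) (t : ℝ) (l : ℕ) (k : M.cells →₀ ℕ) : ℝ :=
  Filter.limUnder Filter.atTop fun N : ℕ =>
    ((N : ℝ) / t)⁻¹ * MvPowerSeries.coeff k (M.correlator N t l)

/-- `|l⃗| - 2 χ(C)`, for a cell `C` with perimeters `l⃗`. -/
def cellDegree (C : Cell) : ℕ := ((C.2.sum : ℤ) - 2 * eulerChar C).toNat

/-- The planar coefficient of `x ^ (-(l+1))` and of the monomial `k` is a constant times
`t ^ v` with `2 v = 2 + l + tDegree k`. -/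
def Params.tDegree (M : Params) (k : M.cells →₀ ℕ) : ℕ := k.sum fun C n => n * cellDegree C.1

/-- The coefficients of `W_{0,1}` are power series in `t` whose coefficients are polynomials in the
Boltzmann weights.  This is the term of order `t ^ ((2 + l + e) / 2)`, evaluated at the actual
Boltzmann weights and at the actual `t`. -/
def Params.planarTerm (M : Params) (t : ℝ) (l e : ℕ) : ℝ :=
  ∑ᶠ (k : M.cells →₀ ℕ) (_ : M.tDegree k = e),
    M.planarCoeff t l k * k.prod fun C n => M.weight t C.1 ^ n

/-- The value of the coefficient of `x ^ (-(l+1))` in `W_{0,1}(x)`. -/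
def Params.planarMoment (M : Params) (t : ℝ) (l : ℕ) : ℝ := ∑' e, M.planarTerm t l e

/-! ### The large-`N` spectral distribution -/

/-- The interval `[a, b]` as a subset of `ℂ`. -/
def cut (a b : ℝ) : Set ℂ := (fun s : ℝ => (s : ℂ)) '' Set.Icc a b

/-- `φ` is the density of the large-`N` spectral distribution: the generating series of the
coefficients of `W_{0,1}` converges near `∞` to a holomorphic function `W` on `ℂ ∖ [a, b]`, and `φ`
is its jump discontinuity `(W(s - i0) - W(s + i0)) / (2πi)`, positive on `(a, b)`. -/
structure Params.IsSpectralDensity (M : Params) (t : ℝ) (W : ℂ → ℂ) (a b : ℝ) (φ : ℝ → ℝ) :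
    Prop where
  lt : a < b
  summable : ∀ l, Summable (M.planarTerm t l)
  holomorphic : DifferentiableOn ℂ W (cut a b)ᶜ
  laurent : ∀ᶠ x in Bornology.cobounded ℂ,
    HasSum (fun l : ℕ => (M.planarMoment t l : ℂ) / x ^ (l + 1)) (W x)
  jump : ∀ s ∈ Set.Ioo a b, ∃ Wp Wm : ℂ,
    Filter.Tendsto (fun ε : ℝ => W (s + Complex.I * ε)) (𝓝[>] 0) (𝓝 Wp) ∧
    Filter.Tendsto (fun ε : ℝ => W (s - Complex.I * ε)) (𝓝[>] 0) (𝓝 Wm) ∧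
    (φ s : ℂ) = 1 / (2 * Real.pi * Complex.I) * (Wm - Wp)
  pos : ∀ s ∈ Set.Ioo a b, 0 < φ s
  zero : ∀ s ∉ Set.Ioo a b, φ s = 0

/-- The measure `μ = φ(s) ds`. -/
def spectralMeasure (φ : ℝ → ℝ) : MeasureTheory.Measure ℝ :=
  MeasureTheory.volume.withDensity fun s => ENNReal.ofReal (φ s)

/-- The Stieltjes transform `∫ dμ(s) / (x - s)`. -/
def stieltjes (μ : MeasureTheory.Measure ℝ) (x : ℂ) : ℂ := ∫ s : ℝ, 1 / (x - s) ∂μ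

/-- The moments of a measure on `ℝ`. -/
def moment (μ : MeasureTheory.Measure ℝ) (l : ℕ) : ℝ := ∫ s : ℝ, s ^ l ∂μ

/-! ### The coefficients of the quadratic equation -/

/-- The polynomial `Q`, for the moments `m`. -/
def Params.polyQ (M : Params) (t : ℝ) (m : ℕ → ℝ) : Polynomial ℝ :=
  -Polynomial.X
    + ∑ l ∈ Finset.Icc 3 M.d, Polynomial.C (M.weight t (0, {l})) * Polynomial.X ^ (l - 1)
    + Polynomial.C (1 / 2) * ∑ l ∈ cylinderIndex M.d,
        Polynomial.C (M.weight t (0, {l.1, l.2})) *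
          (Polynomial.C (m l.2 / l.2) * Polynomial.X ^ (l.1 - 1)
            + Polynomial.C (m l.1 / l.1) * Polynomial.X ^ (l.2 - 1))

/-- `∑_{n=0}^{l-2} m_{l-2-n} X^n`, which is zero for `l = 1`. -/
def momentPoly (m : ℕ → ℝ) (l : ℕ) : Polynomial ℝ :=
  ∑ n ∈ Finset.range (l - 1), Polynomial.C (m (l - 2 - n)) * Polynomial.X ^ n

/-- The polynomial `P`, for the moments `m`. -/
def Params.polyP (M : Params) (t : ℝ) (m : ℕ → ℝ) : Polynomial ℝ :=
  Polynomial.C t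
    - ∑ l ∈ Finset.Icc 3 M.d, Polynomial.C (M.weight t (0, {l})) * momentPoly m l
    - Polynomial.C (1 / 2) * ∑ l ∈ cylinderIndex M.d,
        Polynomial.C (M.weight t (0, {l.1, l.2})) *
          (Polynomial.C (m l.2 / l.2) * momentPoly m l.1
            + Polynomial.C (m l.1 / l.1) * momentPoly m l.2)

end RandomGeometry

end

/-!
The quadratic equation is the planar loop equation of the model, summed over all moments.

*Loop equations.* Integration by parts along the vector field `H ↦ H ^ l` on Hermitian matrices
gives the Schwinger–Dyson equations for the Gaussian means of products of traces
(`multiMean_schwinger_dyson`).  Each coefficient of `ρ₀[Φ · ∏ Tr (H ^ lᵢ)]` as a power series in the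
Boltzmann weights is a constant times such a mean, so the equations pass to the formal matrix
integral and, after division by the partition function and rescaling by powers of `N / t`, to the
normalised correlators (`scaledCorrelator_schwinger_dyson`).  There a cell of genus `g` is
suppressed by `(t / N) ^ (2 g)`, and the term that merges two traces by `(t / N) ^ 2`.

*The planar limit.* The equations determine each coefficient of a correlator from coefficients
of smaller degree in the Boltzmann weights, or of the same degree with fewer or shorter traces.
Induction along this order shows that all coefficients converge as `N → ∞`
(`exists_tendsto_coeff_scaledCorrelator`) and that the limits factorise over the traces
(`planarSeries_add`).  In the limit only the disks and the cylinders survive.  Sending a series in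
the Boltzmann weights, graded by the power of `t`, to its sum is multiplicative, because
convergence of real series is absolute; hence the planar moments themselves satisfy the
loop equations (`planarMoment_succ`).

*The quadratic equation.* Multiplied by `x ^ (-(l + 1))` and summed over `l`, these say that
`W ^ 2 + Q W + P = 0` near infinity, where the coefficients of `Q` and `P` are those of `W` in place
of the moments of `μ`.  The identity theorem extends the equation to the connected complement of
the cut (`quadratic_compl_cut`).

*The spectral measure.* Nothing is assumed about `W` at the end points `a`, `b` of the cut, but the
roots of a monic quadratic polynomial are bounded by its coefficients, so `W` is bounded near
the whole cut (`exists_bound_of_norm_le`).  Therefore contours can be contracted to the cut: for `h`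
holomorphic off the cut and bounded near it, the integral of the jump of `h` is `2πi` times the limit
of `z h(z)` at infinity (`integral_jump`).  Applied to `z ^ l W(z)` minus its polynomial part at
infinity, this shows that the moments of `μ` are the coefficients of `W`; applied to the difference
quotient `(W(z) - W(x)) / (z - x)`, it shows that `W` is the Stieltjes transform of `μ`.
-/

noncomputable section

namespace RandomGeometry

/-! ### Hermitian coordinates -/

section HermitianCoordinates

/-- The Hermitian matrix whose only nonzero real coordinate is the one at `p`, with value `1`. -/
def hermitianBasis {N : ℕ} (p : Fin N × Fin N) : Matrix (Fin N) (Fin N) ℂ :=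
  hermitianOf (Pi.single p 1)

/-- The inverse squared Hilbert–Schmidt norm of `hermitianBasis p`. -/
def hermitianWeight {N : ℕ} (p : Fin N × Fin N) : ℝ := if p.1 = p.2 then 1 else 1 / 2

lemma hermitianOf_add_smul {N : ℕ} (x y : Fin N × Fin N → ℝ) (s : ℝ) :
    hermitianOf (x + s • y) = hermitianOf x + s • hermitianOf y := by
  ext i j
  simp only [hermitianOf, Pi.add_apply, Pi.smul_apply, smul_eq_mul, Matrix.add_apply,
    Matrix.smul_apply, Complex.real_smul]
  split_ifs <;> push_cast <;> ring

lemma hermitianBasis_isHermitian {N : ℕ} (p : Fin N × Fin N) :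
    (hermitianBasis p).IsHermitian := hermitianOf_isHermitian _

lemma hermitianBasis_apply {N : ℕ} (u v k l : Fin N) :
    hermitianBasis (u, v) k l =
      if u = v then (if k = u ∧ l = u then 1 else 0)
      else if u < v then (if (k = u ∧ l = v) ∨ (k = v ∧ l = u) then 1 else 0)
      else (if k = v ∧ l = u then Complex.I else if k = u ∧ l = v then -Complex.I else 0) := by
  simp only [hermitianBasis, hermitianOf, Pi.single_apply, Prod.mk.injEq,
    apply_ite (Complex.ofReal), Complex.ofReal_one, Complex.ofReal_zero]
  rcases lt_trichotomy u v with h | h | h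
  · have h1 := h.ne
    have h2 := h.not_gt
    rcases lt_trichotomy k l with h' | h' | h' <;> grind
  · rcases lt_trichotomy k l with h' | h' | h' <;> grind
  · have h1 := h.ne
    have h2 := h.not_gt
    rcases lt_trichotomy k l with h' | h' | h' <;> grind

/-- The completeness relation of the Hermitian basis: contracting two basis matrices swaps
their indices. -/
lemma hermitianBasis_completeness {N : ℕ} (i j k l : Fin N) :
    ∑ p : Fin N × Fin N, (hermitianWeight p : ℂ) * (hermitianBasis p i j * hermitianBasis p k l) =
      if i = l ∧ j = k then 1 else 0 := by
  have hzero : ∀ p : Fin N × Fin N, p ≠ (i, j) → p ≠ (j, i) → hermitianBasis p i j = 0 := by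
    rintro ⟨u, v⟩ h1 h2
    rw [hermitianBasis_apply]
    simp only [ne_eq, Prod.mk.injEq] at h1 h2
    grind
  by_cases hij : i = j
  · subst hij
    rw [Finset.sum_eq_single (i, i)]
    · simp only [hermitianBasis_apply, hermitianWeight]
      by_cases h : k = i ∧ l = i
      · simp [h]
      · simp only [h]; simp; grind
    · intro p _ hp
      rw [hzero p hp hp]; simp
    · simp
  · rw [← Finset.sum_subset (Finset.subset_univ {(i, j), (j, i)}), Finset.sum_pair]
    · have hji : j ≠ i := Ne.symm hij
      have hI := Complex.I_mul_I
      have e1 : hermitianWeight (i, j) = 1 / 2 := by simp [hermitianWeight, hij]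
      have e2 : hermitianWeight (j, i) = 1 / 2 := by simp [hermitianWeight, hji]
      rw [e1, e2]
      simp only [hermitianBasis_apply]
      push_cast
      rcases lt_or_gt_of_ne hij with h | h
      · have h' := h.not_gt
        grind
      · have h' := h.not_gt
        grind
    · simp [hij]
    · intro p _ hp
      simp only [Finset.mem_insert, Finset.mem_singleton, not_or] at hp
      rw [hzero p hp.1 hp.2]; simp

/-- Contraction of two traces merges them. -/
lemma sum_trace_mul_trace {N : ℕ} (A B : Matrix (Fin N) (Fin N) ℂ) :
    ∑ p : Fin N × Fin N, (hermitianWeight p : ℂ) *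
      ((A * hermitianBasis p).trace * (B * hermitianBasis p).trace) = (A * B).trace := by
  have h : ∀ p : Fin N × Fin N, (hermitianWeight p : ℂ) *
      ((A * hermitianBasis p).trace * (B * hermitianBasis p).trace) =
      ∑ i, ∑ j, ∑ k, ∑ l, A i j * B k l *
        ((hermitianWeight p : ℂ) * (hermitianBasis p j i * hermitianBasis p l k)) := by
    intro p
    simp only [Matrix.trace, Matrix.diag, Matrix.mul_apply]
    rw [Finset.sum_mul, Finset.mul_sum]
    refine Finset.sum_congr rfl fun i _ => ?_
    rw [Finset.sum_mul, Finset.mul_sum]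
    refine Finset.sum_congr rfl fun j _ => ?_
    rw [Finset.mul_sum, Finset.mul_sum]
    refine Finset.sum_congr rfl fun k _ => ?_
    rw [Finset.mul_sum, Finset.mul_sum]
    exact Finset.sum_congr rfl fun l _ => by ring
  simp only [h]
  rw [Finset.sum_comm]
  simp only [Matrix.trace, Matrix.diag, Matrix.mul_apply]
  refine Finset.sum_congr rfl fun i _ => ?_
  rw [Finset.sum_comm]
  refine Finset.sum_congr rfl fun j _ => ?_
  rw [Finset.sum_comm]
  rw [Finset.sum_eq_single j]
  · rw [Finset.sum_comm, Finset.sum_eq_single i]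
    · rw [← Finset.mul_sum, hermitianBasis_completeness]; simp
    · intro l _ hl
      rw [← Finset.mul_sum, hermitianBasis_completeness]; simp [hl.symm]
    · simp
  · intro k _ hk
    rw [Finset.sum_comm]
    refine Finset.sum_eq_zero fun l _ => ?_
    rw [← Finset.mul_sum, hermitianBasis_completeness]; simp [hk.symm]
  · simp

/-- Contraction inside a trace splits it. -/
lemma sum_trace_sandwich {N : ℕ} (A B : Matrix (Fin N) (Fin N) ℂ) :
    ∑ p : Fin N × Fin N, (hermitianWeight p : ℂ) *
      (A * hermitianBasis p * B * hermitianBasis p).trace = A.trace * B.trace := by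
  have h : ∀ p : Fin N × Fin N, (hermitianWeight p : ℂ) *
      (A * hermitianBasis p * B * hermitianBasis p).trace =
      ∑ i, ∑ l, ∑ k, ∑ j, A i j * B k l *
        ((hermitianWeight p : ℂ) * (hermitianBasis p j k * hermitianBasis p l i)) := by
    intro p
    simp only [Matrix.trace, Matrix.diag, Matrix.mul_apply, Finset.sum_mul, Finset.mul_sum]
    refine Finset.sum_congr rfl fun i _ => Finset.sum_congr rfl fun j _ =>
      Finset.sum_congr rfl fun k _ => Finset.sum_congr rfl fun l _ => by ring
  simp only [h]
  rw [Finset.sum_comm]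
  simp only [Matrix.trace, Matrix.diag]
  rw [Finset.sum_mul_sum]
  refine Finset.sum_congr rfl fun i _ => ?_
  rw [Finset.sum_comm]
  refine Finset.sum_congr rfl fun l _ => ?_
  rw [Finset.sum_comm, Finset.sum_eq_single l]
  · rw [Finset.sum_comm, Finset.sum_eq_single i]
    · rw [← Finset.mul_sum, hermitianBasis_completeness]; simp
    · intro j _ hj
      rw [← Finset.mul_sum, hermitianBasis_completeness]; simp [hj]
    · simp
  · intro k _ hk
    rw [Finset.sum_comm]
    refine Finset.sum_eq_zero fun j _ => ?_
    rw [← Finset.mul_sum, hermitianBasis_completeness]; simp [hk]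
  · simp

lemma trace_mul_real {N : ℕ} {A B : Matrix (Fin N) (Fin N) ℂ} (hA : A.IsHermitian)
    (hB : B.IsHermitian) : (A * B).trace = (((A * B).trace).re : ℂ) := by
  have h := Matrix.trace_conjTranspose (A * B)
  rw [Matrix.conjTranspose_mul, hA.eq, hB.eq, Matrix.trace_mul_comm] at h
  exact (Complex.conj_eq_iff_re.mp h.symm).symm

/-- `Re Tr (H ^ l E_p)`, the derivative of `Tr (H ^ (l + 1)) / (l + 1)` along the coordinate `p`. -/
def coordTrace {N : ℕ} (H : Matrix (Fin N) (Fin N) ℂ) (l : ℕ) (p : Fin N × Fin N) : ℝ :=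
  ((H ^ l * hermitianBasis p).trace).re

lemma sum_coordTrace_mul {N : ℕ} {H : Matrix (Fin N) (Fin N) ℂ} (hH : H.IsHermitian) (l m : ℕ) :
    ∑ p, hermitianWeight p * (coordTrace H l p * coordTrace H m p) = trPow H (l + m) := by
  have h := sum_trace_mul_trace (H ^ l) (H ^ m)
  rw [← pow_add, trace_real hH] at h
  apply Complex.ofReal_injective
  rw [← h]
  push_cast
  refine Finset.sum_congr rfl fun p _ => ?_
  rw [trace_mul_real (hH.pow l) (hermitianBasis_isHermitian p),
    trace_mul_real (hH.pow m) (hermitianBasis_isHermitian p)]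
  rfl

lemma sum_sandwich_re {N : ℕ} {H : Matrix (Fin N) (Fin N) ℂ} (hH : H.IsHermitian) (l m : ℕ) :
    ∑ p, hermitianWeight p * ((H ^ l * hermitianBasis p * H ^ m * hermitianBasis p).trace).re =
      trPow H l * trPow H m := by
  have h := congrArg Complex.re (sum_trace_sandwich (H ^ l) (H ^ m))
  rw [trace_real hH, trace_real hH] at h
  simp only [Complex.re_sum, Complex.re_ofReal_mul] at h
  rw [h]
  simp

/-! ### Derivatives of trace invariants -/

/-- The derivative of a matrix power along a line, entry by entry. -/
lemma hasDerivAt_pow_line {N : ℕ} (A B : Matrix (Fin N) (Fin N) ℂ) (n : ℕ) (i j : Fin N) :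
    HasDerivAt (fun s : ℝ => ((A + s • B) ^ n) i j)
      ((∑ m ∈ Finset.range n, A ^ m * B * A ^ (n - 1 - m)) i j) 0 := by
  have h1 : ∀ i j, HasDerivAt (fun s : ℝ => (A + s • B) i j) (B i j) 0 := by
    intro i j
    have := ((hasDerivAt_id (0 : ℝ)).smul_const (B i j)).const_add (A i j)
    simpa using this
  induction n generalizing i j with
  | zero => simpa using hasDerivAt_const (0 : ℝ) ((1 : Matrix (Fin N) (Fin N) ℂ) i j)
  | succ n ih =>
    have h2 := HasDerivAt.fun_sum (u := Finset.univ) fun k _ => (ih i k).mul (h1 k j)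
    have e : (fun s : ℝ => ((A + s • B) ^ (n + 1)) i j) = fun s : ℝ =>
        ∑ k, ((fun s : ℝ => ((A + s • B) ^ n) i k) * fun s : ℝ => (A + s • B) k j) s := by
      ext s
      rw [pow_succ, Matrix.mul_apply]
      rfl
    rw [e]
    refine h2.congr_deriv ?_
    have e2 : ∑ m ∈ Finset.range (n + 1), A ^ m * B * A ^ (n + 1 - 1 - m) =
        (∑ m ∈ Finset.range n, A ^ m * B * A ^ (n - 1 - m)) * A + A ^ n * B := by
      rw [Finset.sum_range_succ, Finset.sum_mul]
      simp only [Nat.add_sub_cancel, Nat.sub_self, pow_zero, mul_one]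
      congr 1
      refine Finset.sum_congr rfl fun m hm => ?_
      rw [mul_assoc _ _ A, ← pow_succ]
      have := Finset.mem_range.mp hm
      congr 2
      omega
    rw [e2, Matrix.add_apply, Matrix.mul_apply, Matrix.mul_apply, ← Finset.sum_add_distrib]
    simp

lemma hasDerivAt_trace_pow_mul {N : ℕ} (A B C : Matrix (Fin N) (Fin N) ℂ) (n : ℕ) :
    HasDerivAt (fun s : ℝ => (((A + s • B) ^ n * C).trace).re)
      (∑ m ∈ Finset.range n, ((A ^ m * B * A ^ (n - 1 - m) * C).trace).re) 0 := by
  have h := HasDerivAt.fun_sum (u := Finset.univ) fun i _ => HasDerivAt.fun_sum (u := Finset.univ)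
    fun j _ => (hasDerivAt_pow_line A B n i j).mul_const (C j i)
  have h' := Complex.reCLM.hasFDerivAt.comp_hasDerivAt (0 : ℝ) h
  refine h'.congr_deriv ?_
  rw [← Complex.re_sum, ← Matrix.trace_sum, ← Finset.sum_mul]
  rfl

lemma hasLineDerivAt_coordTrace {N : ℕ} (x : Fin N × Fin N → ℝ) (l : ℕ) (p : Fin N × Fin N) :
    HasLineDerivAt ℝ (fun x => coordTrace (hermitianOf x) l p)
      (∑ m ∈ Finset.range l, ((hermitianOf x ^ m * hermitianBasis p * hermitianOf x ^ (l - 1 - m) *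
        hermitianBasis p).trace).re) x (Pi.single p 1) := by
  have h := hasDerivAt_trace_pow_mul (hermitianOf x) (hermitianBasis p) (hermitianBasis p) l
  rw [HasLineDerivAt]
  simp only [hermitianOf_add_smul]
  exact h

lemma hasLineDerivAt_trPow {N : ℕ} (x : Fin N × Fin N → ℝ) (n : ℕ) (p : Fin N × Fin N) :
    HasLineDerivAt ℝ (fun x => trPow (hermitianOf x) n)
      (n * coordTrace (hermitianOf x) (n - 1) p) x (Pi.single p 1) := by
  have h := hasDerivAt_trace_pow_mul (hermitianOf x) (hermitianBasis p) 1 n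
  rw [HasLineDerivAt]
  have e : ∀ m ∈ Finset.range n, ((hermitianOf x ^ m * hermitianBasis p *
      hermitianOf x ^ (n - 1 - m) * 1).trace).re = coordTrace (hermitianOf x) (n - 1) p := by
    intro m hm
    have := Finset.mem_range.mp hm
    rw [coordTrace, mul_one, Matrix.trace_mul_comm, ← mul_assoc, ← pow_add]
    congr 4
    omega
  rw [Finset.sum_congr rfl e] at h
  simp only [mul_one, Finset.sum_const, Finset.card_range, nsmul_eq_mul] at h
  simp only [hermitianOf_add_smul]
  exact h

/-- The multi-trace `∏_{l ∈ L} Tr (H ^ l)`. -/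
def multiTrace {N : ℕ} (L : Multiset ℕ) (H : Matrix (Fin N) (Fin N) ℂ) : ℝ :=
  (L.map (trPow H)).prod

lemma hasLineDerivAt_multiTrace {N : ℕ} (x : Fin N × Fin N → ℝ) (L : Multiset ℕ)
    (p : Fin N × Fin N) :
    HasLineDerivAt ℝ (fun x => multiTrace L (hermitianOf x))
      ((L.map fun j : ℕ => j * (coordTrace (hermitianOf x) (j - 1) p *
        multiTrace (L.erase j) (hermitianOf x))).sum) x (Pi.single p 1) := by
  have h := HasFDerivAt.multiset_prod (u := L) (x := (0 : ℝ))
    (g := fun j (s : ℝ) => trPow (hermitianOf (x + s • Pi.single p 1)) j)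
    (fun j _ => HasDerivAt.hasFDerivAt (hasLineDerivAt_trPow x j p))
  rw [HasLineDerivAt]
  refine h.hasDerivAt.congr_deriv ?_
  rw [← ContinuousLinearMap.apply_apply (v := (1 : ℝ)), map_multiset_sum, Multiset.map_map]
  congr 1
  refine Multiset.map_congr rfl fun j _ => ?_
  simp [multiTrace]
  ring

end HermitianCoordinates

/-! ### Gaussian integrals of polynomially bounded functions -/

section GaussianIntegrals

open MeasureTheory

/-- A continuous function that grows at most polynomially at infinity. -/
def PolyGrowth {E F : Type*} [NormedAddCommGroup E] [NormedAddCommGroup F] (f : E → F) : Prop :=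
  Continuous f ∧ ∃ (C : ℝ) (n : ℕ), ∀ x, ‖f x‖ ≤ C * (1 + ‖x‖) ^ n

namespace PolyGrowth

variable {E : Type*} [NormedAddCommGroup E]

lemma const {F : Type*} [NormedAddCommGroup F] (c : F) : PolyGrowth fun _ : E => c :=
  ⟨continuous_const, ‖c‖, 0, fun x => by simp⟩

lemma add {F : Type*} [NormedAddCommGroup F] {f g : E → F} (hf : PolyGrowth f)
    (hg : PolyGrowth g) : PolyGrowth fun x => f x + g x := by
  obtain ⟨hf, C, n, hC⟩ := hf
  obtain ⟨hg, D, m, hD⟩ := hg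
  refine ⟨hf.add hg, |C| + |D|, n + m, fun x => ?_⟩
  have h1 : (1 : ℝ) ≤ 1 + ‖x‖ := by linarith [norm_nonneg x]
  calc ‖f x + g x‖ ≤ ‖f x‖ + ‖g x‖ := norm_add_le _ _
    _ ≤ C * (1 + ‖x‖) ^ n + D * (1 + ‖x‖) ^ m := add_le_add (hC x) (hD x)
    _ ≤ |C| * (1 + ‖x‖) ^ (n + m) + |D| * (1 + ‖x‖) ^ (n + m) := by
      gcongr
      exacts [le_abs_self C, Nat.le_add_right n m, le_abs_self D, Nat.le_add_left m n]
    _ = _ := by ring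

lemma sum {F ι : Type*} [NormedAddCommGroup F] {s : Finset ι} {f : ι → E → F}
    (hf : ∀ i ∈ s, PolyGrowth (f i)) : PolyGrowth fun x => ∑ i ∈ s, f i x := by
  classical
  induction s using Finset.induction_on with
  | empty => simpa using const (0 : F)
  | insert a s ha ih =>
    simp only [Finset.sum_insert ha]
    exact (hf a (by simp)).add (ih fun i hi => hf i (by simp [hi]))

lemma mul {F : Type*} [NormedRing F] {f g : E → F} (hf : PolyGrowth f)
    (hg : PolyGrowth g) : PolyGrowth fun x => f x * g x := by
  obtain ⟨hf, C, n, hC⟩ := hf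
  obtain ⟨hg, D, m, hD⟩ := hg
  refine ⟨hf.mul hg, C * D, n + m, fun x => ?_⟩
  calc ‖f x * g x‖ ≤ ‖f x‖ * ‖g x‖ := norm_mul_le _ _
    _ ≤ (C * (1 + ‖x‖) ^ n) * (D * (1 + ‖x‖) ^ m) :=
      mul_le_mul (hC x) (hD x) (norm_nonneg _) ((norm_nonneg _).trans (hC x))
    _ = _ := by ring

lemma multisetProd {F ι : Type*} [NormedCommRing F] (s : Multiset ι) {f : ι → E → F}
    (hf : ∀ i, PolyGrowth (f i)) : PolyGrowth fun x => (s.map fun i => f i x).prod := by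
  induction s using Multiset.induction with
  | empty => simpa using const (1 : F)
  | cons a s ih => simpa using (hf a).mul ih

lemma multisetSum {F ι : Type*} [NormedAddCommGroup F] (s : Multiset ι) {f : ι → E → F}
    (hf : ∀ i, PolyGrowth (f i)) : PolyGrowth fun x => (s.map fun i => f i x).sum := by
  induction s using Multiset.induction with
  | empty => simpa using const (0 : F)
  | cons a s ih => simpa using (hf a).add ih

lemma re {f : E → ℂ} (hf : PolyGrowth f) : PolyGrowth fun x => (f x).re := by
  obtain ⟨hf, C, n, hC⟩ := hf
  exact ⟨Complex.continuous_re.comp hf, C, n, fun x => (Complex.abs_re_le_norm _).trans (hC x)⟩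

lemma ofReal {f : E → ℝ} (hf : PolyGrowth f) : PolyGrowth fun x => (f x : ℂ) := by
  obtain ⟨hf, C, n, hC⟩ := hf
  exact ⟨Complex.continuous_ofReal.comp hf, C, n, fun x => by simpa using hC x⟩

lemma coord {ι : Type*} [Fintype ι] (i : ι) : PolyGrowth fun x : ι → ℝ => x i :=
  ⟨continuous_apply i, 1, 1, fun x => by
    have := norm_le_pi_norm x i
    simp only [one_mul, pow_one]
    linarith⟩

end PolyGrowth

lemma polyGrowth_hermitianOf {N : ℕ} (i j : Fin N) :
    PolyGrowth fun x : Fin N × Fin N → ℝ => hermitianOf x i j := by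
  simp only [hermitianOf]
  split_ifs
  · exact (PolyGrowth.coord _).ofReal
  · exact (PolyGrowth.coord _).ofReal.add
      ((PolyGrowth.const Complex.I).mul (PolyGrowth.coord _).ofReal)
  · simp only [sub_eq_add_neg, ← neg_mul]
    exact (PolyGrowth.coord _).ofReal.add
      ((PolyGrowth.const (-Complex.I)).mul (PolyGrowth.coord _).ofReal)

lemma polyGrowth_hermitianOf_pow {N : ℕ} (l : ℕ) (i j : Fin N) :
    PolyGrowth fun x : Fin N × Fin N → ℝ => (hermitianOf x ^ l) i j := by
  induction l generalizing i j with
  | zero => simpa using PolyGrowth.const _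
  | succ l ih =>
    simp only [pow_succ, Matrix.mul_apply]
    exact PolyGrowth.sum fun k _ => (ih i k).mul (polyGrowth_hermitianOf k j)

lemma polyGrowth_trace_mul {N : ℕ} {A B : (Fin N × Fin N → ℝ) → Matrix (Fin N) (Fin N) ℂ}
    (hA : ∀ i j, PolyGrowth fun x => A x i j) (hB : ∀ i j, PolyGrowth fun x => B x i j) :
    PolyGrowth fun x => ((A x * B x).trace).re := by
  simp only [Matrix.trace, Matrix.diag, Matrix.mul_apply]
  exact (PolyGrowth.sum fun i _ => PolyGrowth.sum fun j _ => (hA i j).mul (hB j i)).re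

lemma polyGrowth_mul {N : ℕ} {A B : (Fin N × Fin N → ℝ) → Matrix (Fin N) (Fin N) ℂ}
    (hA : ∀ i j, PolyGrowth fun x => A x i j) (hB : ∀ i j, PolyGrowth fun x => B x i j)
    (i j : Fin N) : PolyGrowth fun x => (A x * B x) i j := by
  simp only [Matrix.mul_apply]
  exact PolyGrowth.sum fun k _ => (hA i k).mul (hB k j)

lemma polyGrowth_coordTrace {N : ℕ} (l : ℕ) (p : Fin N × Fin N) :
    PolyGrowth fun x : Fin N × Fin N → ℝ => coordTrace (hermitianOf x) l p :=
  polyGrowth_trace_mul (polyGrowth_hermitianOf_pow l) fun _ _ => PolyGrowth.const _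

lemma polyGrowth_trPow {N : ℕ} (l : ℕ) :
    PolyGrowth fun x : Fin N × Fin N → ℝ => trPow (hermitianOf x) l := by
  simp only [trPow, Matrix.trace, Matrix.diag]
  exact (PolyGrowth.sum fun i _ => polyGrowth_hermitianOf_pow l i i).re

lemma polyGrowth_multiTrace {N : ℕ} (L : Multiset ℕ) :
    PolyGrowth fun x : Fin N × Fin N → ℝ => multiTrace L (hermitianOf x) :=
  PolyGrowth.multisetProd L fun l => polyGrowth_trPow l

/-- The Gaussian weight dominates in all directions; the norm is the sup norm of the real
coordinates. -/
lemma norm_sq_le_trPow_two {N : ℕ} (x : Fin N × Fin N → ℝ) :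
    ‖x‖ ^ 2 ≤ trPow (hermitianOf x) 2 := by
  have e : trPow (hermitianOf x) 2 = ∑ i, ∑ j, ‖hermitianOf x i j‖ ^ 2 := by
    simp only [trPow, pow_two, Matrix.trace, Matrix.diag, Matrix.mul_apply, Complex.re_sum]
    refine Finset.sum_congr rfl fun i _ => Finset.sum_congr rfl fun j _ => ?_
    rw [← (hermitianOf_isHermitian x).apply j i, Complex.star_def, Complex.mul_conj,
      Complex.ofReal_re, Complex.normSq_eq_norm_sq, pow_two]
  have h0 : 0 ≤ trPow (hermitianOf x) 2 := by rw [e]; positivity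
  -- every real coordinate is the real or the imaginary part of an entry, up to sign
  have key : ∀ p, ‖x p‖ ≤ Real.sqrt (trPow (hermitianOf x) 2) := by
    rintro ⟨u, v⟩
    refine Real.le_sqrt_of_sq_le ?_
    have hle : ∀ i j, ‖hermitianOf x i j‖ ^ 2 ≤ trPow (hermitianOf x) 2 := by
      intro i j
      rw [e]
      refine le_trans ?_ (Finset.single_le_sum (f := fun i => ∑ j, ‖hermitianOf x i j‖ ^ 2)
        (fun i _ => by positivity) (Finset.mem_univ i))
      exact Finset.single_le_sum (f := fun j => ‖hermitianOf x i j‖ ^ 2)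
        (fun i _ => by positivity) (Finset.mem_univ j)
    rw [Real.norm_eq_abs, sq_abs]
    rcases lt_trichotomy u v with h | h | h
    · refine le_trans ?_ (hle u v)
      rw [← Complex.normSq_eq_norm_sq]
      simp [hermitianOf, h.ne, h, Complex.normSq_apply]
      nlinarith [sq_nonneg (x (v, u))]
    · subst h
      refine le_trans ?_ (hle u u)
      simp [hermitianOf]
    · refine le_trans ?_ (hle v u)
      rw [← Complex.normSq_eq_norm_sq]
      simp [hermitianOf, h.ne, h, Complex.normSq_apply]
      nlinarith [sq_nonneg (x (v, u))]
  have := (pi_norm_le_iff_of_nonneg (Real.sqrt_nonneg _)).mpr key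
  calc ‖x‖ ^ 2 ≤ Real.sqrt (trPow (hermitianOf x) 2) ^ 2 := by gcongr
    _ = _ := Real.sq_sqrt h0

lemma integrable_mul_exp_freeAction {N : ℕ} (hN : N ≠ 0) {t : ℝ} (ht : 0 < t)
    {f : (Fin N × Fin N → ℝ) → ℝ} (hf : PolyGrowth f) :
    Integrable fun x => f x * Real.exp (-freeAction t (hermitianOf x)) := by
  obtain ⟨hc, C, n, hC⟩ := hf
  set c : ℝ := (N : ℝ) / (2 * t) with hcdef
  have hcpos : 0 < c := by positivity
  set r : ℕ := Module.finrank ℝ (Fin N × Fin N → ℝ) + 1 with hr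
  set m : ℕ := n + r
  have hint := integrable_one_add_norm (E := Fin N × Fin N → ℝ) (μ := volume) (r := r)
    (by rw [hr]; push_cast; linarith)
  have hexp : Continuous fun x : Fin N × Fin N → ℝ =>
      Real.exp (-freeAction t (hermitianOf x)) := by
    have := (polyGrowth_trPow (N := N) 2).1
    simp only [freeAction]
    fun_prop
  -- `(1 + s) ^ m ≤ m! e ^ (1 + s)` and `1 + s - c s ^ 2 ≤ 1 + 1 / (4 c)`
  refine (hint.const_mul (C * (m.factorial * Real.exp (1 + 1 / (4 * c))))).mono'
    (hc.mul hexp).aestronglyMeasurable (Filter.Eventually.of_forall fun x => ?_)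
  have h1 : 0 < 1 + ‖x‖ := by positivity
  have hC0 : 0 ≤ C := by
    by_contra h
    have := (norm_nonneg _).trans (hC x)
    have h2 : 0 < (1 + ‖x‖) ^ n := by positivity
    nlinarith
  have hE : Real.exp (-freeAction t (hermitianOf x)) ≤ Real.exp (-(c * ‖x‖ ^ 2)) := by
    rw [freeAction, ← hcdef]
    have := norm_sq_le_trPow_two x
    gcongr
  have hfac : (1 + ‖x‖) ^ m ≤ m.factorial * Real.exp (1 + ‖x‖) := by
    have := Real.pow_div_factorial_le_exp (1 + ‖x‖) h1.le m
    rwa [div_le_iff₀ (by positivity), mul_comm] at this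
  have hq : 1 + ‖x‖ + -(c * ‖x‖ ^ 2) ≤ 1 + 1 / (4 * c) := by
    have : 1 / (4 * c) - ‖x‖ + c * ‖x‖ ^ 2 = (1 - 2 * c * ‖x‖) ^ 2 / (4 * c) := by
      field_simp; ring
    have : 0 ≤ (1 - 2 * c * ‖x‖) ^ 2 / (4 * c) := by positivity
    linarith
  rw [norm_mul, Real.norm_of_nonneg (Real.exp_pos _).le, Real.rpow_neg h1.le, Real.rpow_natCast]
  calc ‖f x‖ * Real.exp (-freeAction t (hermitianOf x))
      ≤ (C * (1 + ‖x‖) ^ n) * Real.exp (-(c * ‖x‖ ^ 2)) := by gcongr; exact hC x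
    _ = C * ((1 + ‖x‖) ^ m * Real.exp (-(c * ‖x‖ ^ 2))) * ((1 + ‖x‖) ^ r)⁻¹ := by
      rw [show m = n + r from rfl, pow_add]; field_simp
    _ ≤ C * ((m.factorial * Real.exp (1 + ‖x‖)) * Real.exp (-(c * ‖x‖ ^ 2))) *
        ((1 + ‖x‖) ^ r)⁻¹ := by gcongr
    _ ≤ C * (m.factorial * Real.exp (1 + 1 / (4 * c))) * ((1 + ‖x‖) ^ r)⁻¹ := by
      rw [mul_assoc (m.factorial : ℝ), ← Real.exp_add]
      gcongr

/-! ### Schwinger–Dyson equations of the Gaussian measure -/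

/-- The Gaussian expectation of a multi-trace.  The value of the normalising constant of
`gaussianMean` is irrelevant below, since it cancels in the correlators. -/
def multiMean (N : ℕ) (t : ℝ) (L : Multiset ℕ) : ℝ := gaussianMean N t (multiTrace L)

lemma hasLineDerivAt_exp_freeAction {N : ℕ} {t : ℝ} (x : Fin N × Fin N → ℝ) (p : Fin N × Fin N) :
    HasLineDerivAt ℝ (fun x => Real.exp (-freeAction t (hermitianOf x)))
      (-((N : ℝ) / t * coordTrace (hermitianOf x) 1 p) *
        Real.exp (-freeAction t (hermitianOf x))) x (Pi.single p 1) := by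
  have h := hasLineDerivAt_trPow x 2 p
  rw [HasLineDerivAt] at h ⊢
  have h2 := ((h.const_mul ((N : ℝ) / (2 * t))).neg).exp
  refine h2.congr_deriv ?_
  simp only [zero_smul, add_zero, freeAction, Pi.neg_apply]
  push_cast
  rw [mul_comm]
  congr 1
  rw [show ((N : ℝ) / (2 * t)) * (2 * coordTrace (hermitianOf x) (2 - 1) p) =
    (2 * (2 : ℝ)⁻¹) * (N / t * coordTrace (hermitianOf x) 1 p) by ring]
  norm_num

/-- Integration by parts along the coordinate `p`, for `Re Tr (H ^ l E_p)` times a multi-trace. -/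
lemma gaussianMean_coord_by_parts {N : ℕ} (hN : N ≠ 0) {t : ℝ} (ht : 0 < t) (l : ℕ)
    (L : Multiset ℕ) (p : Fin N × Fin N) :
    (N : ℝ) / t * gaussianMean N t (fun H =>
        (coordTrace H l p * coordTrace H 1 p) * multiTrace L H) =
      gaussianMean N t fun H => (∑ m ∈ Finset.range l,
          ((H ^ m * hermitianBasis p * H ^ (l - 1 - m) * hermitianBasis p).trace).re) *
            multiTrace L H +
        coordTrace H l p * (L.map fun j : ℕ => j *
          (coordTrace H (j - 1) p * multiTrace (L.erase j) H)).sum := by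
  have hf' : ∀ x : Fin N × Fin N → ℝ, HasLineDerivAt ℝ
      (fun x => coordTrace (hermitianOf x) l p * multiTrace L (hermitianOf x))
      ((∑ m ∈ Finset.range l, ((hermitianOf x ^ m * hermitianBasis p *
          hermitianOf x ^ (l - 1 - m) * hermitianBasis p).trace).re) *
            multiTrace L (hermitianOf x) +
        coordTrace (hermitianOf x) l p * (L.map fun j : ℕ => j *
          (coordTrace (hermitianOf x) (j - 1) p * multiTrace (L.erase j) (hermitianOf x))).sum)
      x (Pi.single p 1) := by
    intro x
    have := HasDerivAt.mul (hasLineDerivAt_coordTrace x l p) (hasLineDerivAt_multiTrace x L p)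
    refine HasDerivAt.congr_deriv this ?_
    simp
  have hc := polyGrowth_coordTrace (N := N) l p
  have hT := polyGrowth_multiTrace (N := N) L
  have hd : PolyGrowth fun x : Fin N × Fin N → ℝ =>
      (∑ m ∈ Finset.range l, ((hermitianOf x ^ m * hermitianBasis p *
          hermitianOf x ^ (l - 1 - m) * hermitianBasis p).trace).re) *
            multiTrace L (hermitianOf x) +
        coordTrace (hermitianOf x) l p * (L.map fun j : ℕ => j *
          (coordTrace (hermitianOf x) (j - 1) p * multiTrace (L.erase j) (hermitianOf x))).sum := by
    refine PolyGrowth.add (PolyGrowth.mul (PolyGrowth.sum fun m _ => ?_) hT) (hc.mul ?_)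
    · refine polyGrowth_trace_mul (polyGrowth_mul (polyGrowth_mul (polyGrowth_hermitianOf_pow m)
        fun i j => PolyGrowth.const _) (polyGrowth_hermitianOf_pow _)) fun i j => PolyGrowth.const _
    · exact PolyGrowth.multisetSum L (f := fun (j : ℕ) (x : Fin N × Fin N → ℝ) => (j : ℝ) *
          (coordTrace (hermitianOf x) (j - 1) p * multiTrace (L.erase j) (hermitianOf x)))
        fun j => (PolyGrowth.const _).mul
          ((polyGrowth_coordTrace _ p).mul (polyGrowth_multiTrace _))
  have hg : PolyGrowth fun x : Fin N × Fin N → ℝ =>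
      (coordTrace (hermitianOf x) l p * multiTrace L (hermitianOf x)) *
        (-((N : ℝ) / t * coordTrace (hermitianOf x) 1 p)) := by
    simp only [← neg_mul]
    exact (hc.mul hT).mul ((PolyGrowth.const _).mul (polyGrowth_coordTrace 1 p))
  have key := integral_bilinear_hasLineDerivAt_right_eq_neg_left_of_integrable
    (μ := (volume : Measure (Fin N × Fin N → ℝ)))
    (B := ContinuousLinearMap.mul ℝ ℝ) (v := Pi.single p 1)
    (by simpa only [ContinuousLinearMap.mul_apply'] using integrable_mul_exp_freeAction hN ht hd)
    (by simpa [mul_assoc] using integrable_mul_exp_freeAction hN ht hg)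
    (by simpa using integrable_mul_exp_freeAction hN ht (hc.mul hT))
    (fun x _ => hf' x) (fun x _ => hasLineDerivAt_exp_freeAction (t := t) x p)
  simp only [ContinuousLinearMap.mul_apply'] at key
  rw [← neg_eq_iff_eq_neg] at key
  rw [gaussianMean, gaussianMean, ← key, ← integral_neg, mul_left_comm, ← integral_const_mul]
  congr 2
  ext x
  ring

lemma gaussianMean_congr {N : ℕ} {t : ℝ} {f g : Matrix (Fin N) (Fin N) ℂ → ℝ}
    (h : ∀ H : Matrix (Fin N) (Fin N) ℂ, H.IsHermitian → f H = g H) :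
    gaussianMean N t f = gaussianMean N t g := by
  simp only [gaussianMean, h _ (hermitianOf_isHermitian _)]

lemma gaussianMean_const_mul {N : ℕ} {t : ℝ} (c : ℝ) (f : Matrix (Fin N) (Fin N) ℂ → ℝ) :
    gaussianMean N t (fun H => c * f H) = c * gaussianMean N t f := by
  simp only [gaussianMean, mul_assoc, integral_const_mul]
  ring

lemma gaussianMean_add {N : ℕ} (hN : N ≠ 0) {t : ℝ} (ht : 0 < t)
    {f g : Matrix (Fin N) (Fin N) ℂ → ℝ} (hf : PolyGrowth fun x => f (hermitianOf x))
    (hg : PolyGrowth fun x => g (hermitianOf x)) :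
    gaussianMean N t (fun H => f H + g H) = gaussianMean N t f + gaussianMean N t g := by
  simp only [gaussianMean, add_mul]
  rw [integral_add (integrable_mul_exp_freeAction hN ht hf)
    (integrable_mul_exp_freeAction hN ht hg), mul_add]

lemma gaussianMean_sum {N : ℕ} (hN : N ≠ 0) {t : ℝ} (ht : 0 < t) {ι : Type*} (s : Finset ι)
    {f : ι → Matrix (Fin N) (Fin N) ℂ → ℝ}
    (hf : ∀ i ∈ s, PolyGrowth fun x => f i (hermitianOf x)) :
    gaussianMean N t (fun H => ∑ i ∈ s, f i H) = ∑ i ∈ s, gaussianMean N t (f i) := by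
  simp only [gaussianMean, Finset.sum_mul]
  rw [integral_finsetSum s fun i hi => integrable_mul_exp_freeAction hN ht (hf i hi),
    Finset.mul_sum]

lemma gaussianMean_multisetSum {N : ℕ} (hN : N ≠ 0) {t : ℝ} (ht : 0 < t) {ι : Type*}
    (s : Multiset ι) {f : ι → Matrix (Fin N) (Fin N) ℂ → ℝ}
    (hf : ∀ i, PolyGrowth fun x => f i (hermitianOf x)) :
    gaussianMean N t (fun H => (s.map fun i => f i H).sum) =
      (s.map fun i => gaussianMean N t (f i)).sum := by
  induction s using Multiset.induction with
  | empty => simp [gaussianMean]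
  | cons a s ih =>
    simp only [Multiset.map_cons, Multiset.sum_cons]
    rw [gaussianMean_add hN ht (hf a) (PolyGrowth.multisetSum s hf), ih]

lemma multiTrace_cons {N : ℕ} (l : ℕ) (L : Multiset ℕ) (H : Matrix (Fin N) (Fin N) ℂ) :
    multiTrace (l ::ₘ L) H = trPow H l * multiTrace L H := by
  simp [multiTrace]

lemma multiMean_zero_cons {N : ℕ} (t : ℝ) (L : Multiset ℕ) :
    multiMean N t (0 ::ₘ L) = N * multiMean N t L := by
  rw [multiMean, multiMean, ← gaussianMean_const_mul]
  exact gaussianMean_congr fun H _ => by rw [multiTrace_cons, trPow_zero]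

/-- The Schwinger–Dyson equations of the Gaussian measure: integration by parts along the vector
field `H ↦ H ^ l` on the space of Hermitian matrices, whose divergence is
`∑_{m < l} Tr (H ^ m) Tr (H ^ (l - 1 - m))`. -/
lemma multiMean_schwinger_dyson {N : ℕ} (hN : N ≠ 0) {t : ℝ} (ht : 0 < t) (l : ℕ)
    (L : Multiset ℕ) :
    (N : ℝ) / t * multiMean N t ((l + 1) ::ₘ L) =
      ∑ m ∈ Finset.range l, multiMean N t (m ::ₘ (l - 1 - m) ::ₘ L) +
      (L.map fun j : ℕ => j * multiMean N t ((l + (j - 1)) ::ₘ L.erase j)).sum := by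
  have hT := fun L => polyGrowth_multiTrace (N := N) L
  have hc := polyGrowth_coordTrace (N := N)
  have hS : ∀ (m l : ℕ) (p : Fin N × Fin N), PolyGrowth fun x : Fin N × Fin N → ℝ =>
      ((hermitianOf x ^ m * hermitianBasis p * hermitianOf x ^ l * hermitianBasis p).trace).re :=
    fun m l p => polyGrowth_trace_mul (polyGrowth_mul (polyGrowth_mul
      (polyGrowth_hermitianOf_pow m) fun _ _ => PolyGrowth.const _)
      (polyGrowth_hermitianOf_pow _)) fun _ _ => PolyGrowth.const _
  have hM : ∀ (L : Multiset ℕ) (p : Fin N × Fin N), PolyGrowth fun x : Fin N × Fin N → ℝ =>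
      (L.map fun j : ℕ => (j : ℝ) * (coordTrace (hermitianOf x) (j - 1) p *
        multiTrace (L.erase j) (hermitianOf x))).sum := fun L p =>
    PolyGrowth.multisetSum L (f := fun (j : ℕ) (x : Fin N × Fin N → ℝ) => (j : ℝ) *
      (coordTrace (hermitianOf x) (j - 1) p * multiTrace (L.erase j) (hermitianOf x)))
      fun j => (PolyGrowth.const _).mul ((hc _ p).mul (hT _))
  have h1 := Finset.sum_congr rfl fun p (_ : p ∈ (Finset.univ : Finset (Fin N × Fin N))) =>
    congrArg (hermitianWeight p * ·) (gaussianMean_coord_by_parts hN ht l L p)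
  simp only [mul_left_comm (hermitianWeight _) ((N : ℝ) / t)] at h1
  rw [← Finset.mul_sum] at h1
  simp only [← gaussianMean_const_mul (hermitianWeight _)] at h1
  rw [← gaussianMean_sum hN ht, ← gaussianMean_sum hN ht] at h1
  rotate_left
  · exact fun p _ => (PolyGrowth.const _).mul (((PolyGrowth.sum fun m _ => hS _ _ _).mul
      (hT _)).add ((hc _ _).mul (hM _ _)))
  · exact fun p _ => (PolyGrowth.const _).mul (((hc _ _).mul (hc _ _)).mul (hT _))
  -- sum the integrations by parts over the coordinates, with the completeness relation
  have e1 : ∀ H : Matrix (Fin N) (Fin N) ℂ, H.IsHermitian →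
      ∑ p, hermitianWeight p * (coordTrace H l p * coordTrace H 1 p * multiTrace L H) =
        multiTrace ((l + 1) ::ₘ L) H := by
    intro H hH
    rw [multiTrace_cons, ← sum_coordTrace_mul hH l 1, Finset.sum_mul]
    exact Finset.sum_congr rfl fun p _ => by ring
  have e2 : ∀ H : Matrix (Fin N) (Fin N) ℂ, H.IsHermitian →
      ∑ p, hermitianWeight p * ((∑ m ∈ Finset.range l,
          ((H ^ m * hermitianBasis p * H ^ (l - 1 - m) * hermitianBasis p).trace).re) *
            multiTrace L H +
        coordTrace H l p * (L.map fun j : ℕ => j *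
          (coordTrace H (j - 1) p * multiTrace (L.erase j) H)).sum) =
      ∑ m ∈ Finset.range l, multiTrace (m ::ₘ (l - 1 - m) ::ₘ L) H +
      (L.map fun j : ℕ => j * multiTrace ((l + (j - 1)) ::ₘ L.erase j) H).sum := by
    intro H hH
    simp only [mul_add, Finset.sum_add_distrib]
    congr 1
    · simp only [Finset.sum_mul, Finset.mul_sum]
      rw [Finset.sum_comm]
      refine Finset.sum_congr rfl fun m _ => ?_
      rw [multiTrace_cons, multiTrace_cons, ← mul_assoc, ← sum_sandwich_re hH, Finset.sum_mul]
      exact Finset.sum_congr rfl fun p _ => by ring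
    · simp only [← Multiset.sum_map_mul_left]
      simp only [Finset.sum_eq_multiset_sum]
      rw [Multiset.sum_map_sum_map]
      refine congrArg _ (Multiset.map_congr rfl fun j _ => ?_)
      rw [multiTrace_cons, ← sum_coordTrace_mul hH, Finset.sum_mul, Finset.mul_sum,
        ← Finset.sum_eq_multiset_sum]
      exact Finset.sum_congr rfl fun p _ => by ring
  rw [gaussianMean_congr e1, gaussianMean_congr e2] at h1
  rw [multiMean, h1, gaussianMean_add hN ht (PolyGrowth.sum fun m _ => hT _)
    (PolyGrowth.multisetSum L (f := fun (j : ℕ) (x : Fin N × Fin N → ℝ) =>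
      (j : ℝ) * multiTrace ((l + (j - 1)) ::ₘ L.erase j) (hermitianOf x))
      fun j => (PolyGrowth.const _).mul (hT _)), gaussianMean_sum hN ht _ fun m _ => hT _,
    gaussianMean_multisetSum hN ht L fun j => (PolyGrowth.const _).mul (hT _)]
  simp only [gaussianMean_const_mul, multiMean]

lemma multiMean_zero_pos {N : ℕ} (hN : N ≠ 0) {t : ℝ} (ht : 0 < t) : 0 < multiMean N t 0 := by
  have hi := integrable_mul_exp_freeAction (N := N) hN ht (PolyGrowth.const (1 : ℝ))
  rw [multiMean, gaussianMean]
  refine mul_pos (by positivity) ?_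
  simp only [multiTrace, Multiset.map_zero, Multiset.prod_zero]
  rw [integral_pos_iff_support_of_nonneg (fun x => by positivity) hi]
  have : Function.support (fun x : Fin N × Fin N → ℝ =>
      1 * Real.exp (-freeAction t (hermitianOf x))) = Set.univ := by
    ext x; simp [(Real.exp_pos _).ne']
  rw [this]
  exact isOpen_univ.measure_pos volume Set.univ_nonempty

end GaussianIntegrals

/-! ### Schwinger–Dyson equations of the formal matrix integral -/

section FormalIntegral

open MvPowerSeries

/-- The combinatorial part of the prefactor of `∏_l Tr (H ^ l)` in the contribution of a cell with
perimeters `l`. -/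
def boundaryFactor (L : Multiset ℕ) : ℝ :=
  (L.card.factorial : ℝ)⁻¹ * (L.map fun l : ℕ => (l : ℝ)⁻¹).prod

lemma cellTerm_eq {N : ℕ} (t : ℝ) (H : Matrix (Fin N) (Fin N) ℂ) (C : Cell) :
    cellTerm t H C = ((N : ℝ) / t) ^ eulerChar C * boundaryFactor C.2 * multiTrace C.2 H := by
  have : (C.2.map (powerSum H)).prod =
      (C.2.map fun l : ℕ => (l : ℝ)⁻¹).prod * multiTrace C.2 H := by
    rw [multiTrace, ← Multiset.prod_map_mul]
    exact congrArg _ (Multiset.map_congr rfl fun l _ => by rw [powerSum, div_eq_inv_mul])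
  rw [cellTerm, this, boundaryFactor]
  ring

/-- All the perimeters in a monomial in the Boltzmann weights. -/
def monomialPerimeters {M : Params} (k : M.cells →₀ ℕ) : Multiset ℕ := ∑ C, k C • C.1.2

/-- The constant in front of the multi-trace in the coefficient of a monomial of `Φ`. -/
def monomialFactor {M : Params} (N : ℕ) (t : ℝ) (k : M.cells →₀ ℕ) : ℝ :=
  ∏ C : M.cells, (((N : ℝ) / t) ^ eulerChar C.1 * boundaryFactor C.1.2) ^ k C /
    ((k C).factorial : ℝ)

lemma multiTrace_add {N : ℕ} (L K : Multiset ℕ) (H : Matrix (Fin N) (Fin N) ℂ) :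
    multiTrace (L + K) H = multiTrace L H * multiTrace K H := by
  simp [multiTrace]

lemma phiCoeff_eq (M : Params) {N : ℕ} (t : ℝ) (H : Matrix (Fin N) (Fin N) ℂ)
    (k : M.cells →₀ ℕ) :
    M.phiCoeff t H k = monomialFactor N t k * multiTrace (monomialPerimeters k) H := by
  have : multiTrace (monomialPerimeters k) H = ∏ C : M.cells, multiTrace C.1.2 H ^ k C := by
    simp only [monomialPerimeters, multiTrace]
    rw [← Multiset.coe_mapAddMonoidHom, map_sum, Multiset.prod_sum]
    simp [Multiset.map_nsmul, Multiset.prod_nsmul]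
  rw [Params.phiCoeff, this, monomialFactor, ← Finset.prod_mul_distrib]
  refine Finset.prod_congr rfl fun C _ => ?_
  rw [cellTerm_eq, mul_pow]
  ring

/-- The formal mean of a multi-trace. -/
def Params.formalMulti (M : Params) (N : ℕ) (t : ℝ) (L : Multiset ℕ) : MvPowerSeries M.cells ℝ :=
  M.formalMean N t (multiTrace L)

lemma coeff_formalMean (M : Params) (N : ℕ) (t : ℝ) (f : Matrix (Fin N) (Fin N) ℂ → ℝ)
    (k : M.cells →₀ ℕ) :
    coeff k (M.formalMean N t f) = gaussianMean N t fun H => f H * M.phiCoeff t H k := by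
  rw [coeff_apply]
  rfl

lemma coeff_formalMulti (M : Params) (N : ℕ) (t : ℝ) (L : Multiset ℕ) (k : M.cells →₀ ℕ) :
    coeff k (M.formalMulti N t L) =
      monomialFactor N t k * multiMean N t (L + monomialPerimeters k) := by
  rw [multiMean, ← gaussianMean_const_mul, Params.formalMulti, coeff_formalMean]
  refine gaussianMean_congr fun H _ => ?_
  rw [phiCoeff_eq, multiTrace_add]
  ring

lemma partitionFunction_eq (M : Params) (N : ℕ) (t : ℝ) :
    M.partitionFunction N t = M.formalMulti N t 0 := by
  ext k
  rw [Params.partitionFunction, Params.formalMulti, coeff_formalMean, coeff_formalMean]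
  exact gaussianMean_congr fun H _ => by simp [multiTrace]

lemma formalMulti_singleton (M : Params) (N : ℕ) (t : ℝ) (l : ℕ) :
    M.formalMean N t (fun H => trPow H l) = M.formalMulti N t {l} := by
  ext k
  rw [Params.formalMulti, coeff_formalMean, coeff_formalMean]
  exact gaussianMean_congr fun H _ => by simp [multiTrace]

lemma formalMulti_zero_cons (M : Params) (N : ℕ) (t : ℝ) (L : Multiset ℕ) :
    M.formalMulti N t (0 ::ₘ L) = (N : ℝ) • M.formalMulti N t L := by
  ext k
  rw [coeff_smul, coeff_formalMulti, coeff_formalMulti, Multiset.cons_add, multiMean_zero_cons]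
  ring

lemma coeff_X_mul' {σ : Type*} (s : σ) (f : MvPowerSeries σ ℝ) (k : σ →₀ ℕ) :
    coeff k (X s * f) =
      if Finsupp.single s 1 ≤ k then coeff (k - Finsupp.single s 1) f else 0 := by
  classical
  rw [X_def, coeff_monomial_mul]
  simp

lemma monomialPerimeters_add_single {M : Params} (k : M.cells →₀ ℕ) (C : M.cells) :
    monomialPerimeters (k + Finsupp.single C 1) = monomialPerimeters k + C.1.2 := by
  classical
  simp only [monomialPerimeters, Finsupp.add_apply, add_smul, Finset.sum_add_distrib]
  congr 1
  rw [Finset.sum_eq_single C]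
  · simp
  · intro D _ hD
    simp [hD.symm]
  · simp

lemma monomialFactor_add_single {M : Params} (N : ℕ) (t : ℝ) (k : M.cells →₀ ℕ) (C : M.cells) :
    ((k C : ℝ) + 1) * monomialFactor N t (k + Finsupp.single C 1) =
      ((N : ℝ) / t) ^ eulerChar C.1 * boundaryFactor C.1.2 * monomialFactor N t k := by
  classical
  simp only [monomialFactor]
  rw [← Finset.mul_prod_erase _ _ (Finset.mem_univ C), ← Finset.mul_prod_erase _ _
    (Finset.mem_univ C)]
  have : ∀ D ∈ Finset.univ.erase C, (k + Finsupp.single C 1 : M.cells →₀ ℕ) D = k D := by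
    intro D hD
    simp [(Finset.ne_of_mem_erase hD).symm]
  rw [Finset.prod_congr rfl fun D hD => by rw [this D hD]]
  simp only [Finsupp.add_apply, Finsupp.single_eq_same, Nat.factorial_succ, pow_succ]
  push_cast
  field_simp

lemma coeff_multiset_sum_smul {σ ι : Type*} (s : Multiset ι) (c : ι → ℝ)
    (f : ι → MvPowerSeries σ ℝ) (k : σ →₀ ℕ) :
    coeff k (s.map fun j => c j • f j).sum = (s.map fun j => c j * coeff k (f j)).sum := by
  rw [map_multiset_sum, Multiset.map_map]
  simp

/-- The Schwinger–Dyson equations of the formal matrix integral: those of the Gaussian measure,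
applied to the traces `L` together with the traces that a monomial of `Φ` carries. -/
lemma formalMulti_schwinger_dyson (M : Params) {N : ℕ} (hN : N ≠ 0) {t : ℝ} (ht : 0 < t) (l : ℕ)
    (L : Multiset ℕ) :
    ((N : ℝ) / t) • M.formalMulti N t ((l + 1) ::ₘ L) =
      ∑ m ∈ Finset.range l, M.formalMulti N t (m ::ₘ (l - 1 - m) ::ₘ L) +
      (L.map fun j : ℕ => (j : ℝ) • M.formalMulti N t ((l + (j - 1)) ::ₘ L.erase j)).sum +
      ∑ C : M.cells, X C * ((((N : ℝ) / t) ^ eulerChar C.1 * boundaryFactor C.1.2) •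
        (C.1.2.map fun j : ℕ => (j : ℝ) •
          M.formalMulti N t ((l + (j - 1)) ::ₘ (C.1.2.erase j + L))).sum) := by
  classical
  ext k
  simp only [map_add, map_sum, coeff_smul, coeff_X_mul', coeff_multiset_sum_smul,
    coeff_formalMulti, Multiset.cons_add]
  rw [mul_left_comm, multiMean_schwinger_dyson hN ht, mul_add, Multiset.map_add, Multiset.sum_add,
    mul_add, ← add_assoc, Finset.mul_sum]
  congr 1
  · congr 1
    rw [← Multiset.sum_map_mul_left]
    refine congrArg _ (Multiset.map_congr rfl fun j hj => ?_)
    rw [Multiset.erase_add_left_pos _ hj]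
    ring
  · -- the derivative of `∏_C (c_C T_C) ^ k_C / k_C!` is `∑_C c_C T_C'` times the term `k - e_C`
    have h1 : ∀ f : ℕ → ℝ, ((monomialPerimeters k).map f).sum =
        ∑ C : M.cells, (k C : ℝ) * (C.1.2.map f).sum := by
      intro f
      rw [monomialPerimeters, ← Multiset.coe_mapAddMonoidHom, map_sum, Multiset.sum_sum]
      simp [Multiset.map_nsmul, Multiset.sum_nsmul]
    rw [h1, Finset.mul_sum]
    refine Finset.sum_congr rfl fun C _ => ?_
    split_ifs with hC
    · obtain ⟨k', rfl⟩ : ∃ k', k = k' + Finsupp.single C 1 :=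
        ⟨k - Finsupp.single C 1, (tsub_add_cancel_of_le hC).symm⟩
      rw [add_tsub_cancel_right, ← mul_assoc, mul_comm (monomialFactor N t _)]
      have h2 := monomialFactor_add_single N t k' C
      simp only [Finsupp.add_apply, Finsupp.single_eq_same, Nat.cast_add, Nat.cast_one]
      rw [h2, mul_assoc _ (monomialFactor N t k'), ← Multiset.sum_map_mul_left,
        monomialPerimeters_add_single]
      congr 2
      refine Multiset.map_congr rfl fun j hj => ?_
      rw [← add_assoc, Multiset.erase_add_right_pos _ hj, add_comm (L + monomialPerimeters k'),
        add_assoc (C.1.2.erase j)]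
      ring
    · have : k C = 0 := by
        by_contra h
        exact hC (Finsupp.single_le_iff.mpr (Nat.one_le_iff_ne_zero.mpr h))
      simp [this]

/-- The normalised correlator `(N/t) ^ (-n) · Z_N⁻¹ ρ₀[Φ · ∏ Tr (H ^ lᵢ)]`, with `n` traces. -/
def Params.scaledCorrelator (M : Params) (N : ℕ) (t : ℝ) (L : Multiset ℕ) :
    MvPowerSeries M.cells ℝ :=
  (t / N) ^ L.card • (M.formalMulti N t L * (M.partitionFunction N t)⁻¹)

lemma scaledCorrelator_empty (M : Params) {N : ℕ} (hN : N ≠ 0) {t : ℝ} (ht : 0 < t) :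
    M.scaledCorrelator N t 0 = 1 := by
  rw [Params.scaledCorrelator, partitionFunction_eq, Multiset.card_zero, pow_zero, one_smul,
    MvPowerSeries.mul_inv_cancel]
  rw [← coeff_zero_eq_constantCoeff_apply, coeff_formalMulti]
  have : monomialFactor N t (0 : M.cells →₀ ℕ) = 1 := by simp [monomialFactor]
  rw [this, one_mul]
  simpa [monomialPerimeters] using (multiMean_zero_pos hN ht).ne'

lemma scaledCorrelator_zero_cons (M : Params) {N : ℕ} (hN : N ≠ 0) (t : ℝ)
    (L : Multiset ℕ) :
    M.scaledCorrelator N t (0 ::ₘ L) = t • M.scaledCorrelator N t L := by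
  have : (N : ℝ) ≠ 0 := Nat.cast_ne_zero.mpr hN
  rw [Params.scaledCorrelator, Params.scaledCorrelator, formalMulti_zero_cons, Multiset.card_cons,
    smul_mul_assoc, smul_smul, smul_smul]
  congr 1
  rw [pow_succ]
  field_simp

lemma scaledCorrelator_singleton (M : Params) (N : ℕ) (t : ℝ) (l : ℕ) :
    M.scaledCorrelator N t {l} = ((N : ℝ) / t)⁻¹ • M.correlator N t l := by
  rw [Params.scaledCorrelator, Params.correlator, formalMulti_singleton, Multiset.card_singleton,
    pow_one, inv_div]

/-- The Schwinger–Dyson equations of the normalised correlators.  Merging two traces costs a factor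
`(t / N) ^ 2`, and a cell of genus `g` a factor `(t / N) ^ (2 * g)`, independent of the number of its
boundaries. -/
lemma scaledCorrelator_schwinger_dyson (M : Params) {N : ℕ} (hN : N ≠ 0) {t : ℝ} (ht : 0 < t)
    (l : ℕ) (L : Multiset ℕ) :
    M.scaledCorrelator N t ((l + 1) ::ₘ L) =
      ∑ m ∈ Finset.range l, M.scaledCorrelator N t (m ::ₘ (l - 1 - m) ::ₘ L) +
      (t / N) ^ 2 • (L.map fun j : ℕ => (j : ℝ) •
        M.scaledCorrelator N t ((l + (j - 1)) ::ₘ L.erase j)).sum +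
      ∑ C : M.cells, (t / N) ^ (2 * C.1.1) • (X C * (boundaryFactor C.1.2 •
        (C.1.2.map fun j : ℕ => (j : ℝ) •
          M.scaledCorrelator N t ((l + (j - 1)) ::ₘ (C.1.2.erase j + L))).sum)) := by
  have hN' : (N : ℝ) ≠ 0 := Nat.cast_ne_zero.mpr hN
  set u : ℝ := t / N with hu
  have hu0 : u ≠ 0 := div_ne_zero ht.ne' hN'
  have hr : (N : ℝ) / t = u⁻¹ := by rw [hu, inv_div]
  have h := congrArg (fun f => u ^ (L.card + 2) • (f * (M.partitionFunction N t)⁻¹))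
    (formalMulti_schwinger_dyson M hN ht l L)
  simp only [hr] at h
  have hl : u ^ (L.card + 2) • (u⁻¹ • M.formalMulti N t ((l + 1) ::ₘ L) *
      (M.partitionFunction N t)⁻¹) = M.scaledCorrelator N t ((l + 1) ::ₘ L) := by
    rw [Params.scaledCorrelator, smul_mul_assoc, smul_smul, Multiset.card_cons, ← hu]
    congr 1
    rw [pow_succ u (L.card + 1)]
    field_simp
  rw [hl] at h
  rw [h, add_mul, add_mul, smul_add, smul_add]
  congr 1
  · congr 1
    · rw [Finset.sum_mul, Finset.smul_sum]
      exact Finset.sum_congr rfl fun m _ => by simp [Params.scaledCorrelator, ← hu]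
    · rw [← Multiset.sum_map_mul_right, Multiset.smul_sum, Multiset.smul_sum, Multiset.map_map,
        Multiset.map_map]
      refine congrArg _ (Multiset.map_congr rfl fun j hj => ?_)
      have hc := Multiset.card_erase_add_one hj
      simp only [Function.comp, Params.scaledCorrelator, Multiset.card_cons, smul_mul_assoc,
        smul_smul, hc, ← hu]
      congr 1
      ring
  · rw [Finset.sum_mul, Finset.smul_sum]
    refine Finset.sum_congr rfl fun C _ => ?_
    have e : (C.1.2.map fun j : ℕ => (j : ℝ) •
          M.scaledCorrelator N t ((l + (j - 1)) ::ₘ (C.1.2.erase j + L))).sum =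
        u ^ (C.1.2.card + L.card) • (C.1.2.map fun j : ℕ => (j : ℝ) •
          M.formalMulti N t ((l + (j - 1)) ::ₘ (C.1.2.erase j + L)) *
            (M.partitionFunction N t)⁻¹).sum := by
      rw [Multiset.smul_sum, Multiset.map_map]
      refine congrArg _ (Multiset.map_congr rfl fun j hj => ?_)
      have hc := Multiset.card_erase_add_one hj
      have hc' : (C.1.2.erase j).card + L.card + 1 = C.1.2.card + L.card := by omega
      simp only [Function.comp, Params.scaledCorrelator, Multiset.card_cons, Multiset.card_add,
        smul_mul_assoc, smul_smul, hc', ← hu]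
      congr 1
      ring
    -- `|L| + 2 - χ = 2 g + β₀ + |L|`
    have hpow : u ^ (L.card + 2) * u⁻¹ ^ eulerChar C.1 =
        u ^ (2 * C.1.1) * u ^ (C.1.2.card + L.card) := by
      rw [← zpow_natCast, ← zpow_natCast, ← zpow_natCast, inv_zpow', ← zpow_add₀ hu0,
        ← zpow_add₀ hu0]
      congr 1
      simp only [eulerChar]
      push_cast
      ring
    rw [e, mul_assoc (X C), smul_mul_assoc, ← Multiset.sum_map_mul_right]
    simp only [mul_smul_comm, smul_smul]
    congr 1
    rw [← mul_assoc, hpow]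
    ring

end FormalIntegral

/-! ### The planar limit -/

section PlanarLimit

open MvPowerSeries Filter

lemma exists_tendsto_multisetSum {ι : Type*} (s : Multiset ι) {f : ι → ℕ → ℝ}
    (h : ∀ j ∈ s, ∃ c, Tendsto (f j) atTop (𝓝 c)) :
    ∃ c, Tendsto (fun N => (s.map fun j => f j N).sum) atTop (𝓝 c) := by
  induction s using Multiset.induction with
  | empty => exact ⟨0, by simp⟩
  | cons a s ih =>
    obtain ⟨c, hc⟩ := h a (by simp)
    obtain ⟨d, hd⟩ := ih fun j hj => h j (by simp [hj])
    exact ⟨c + d, by simpa using hc.add hd⟩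

lemma exists_tendsto_finsetSum {ι : Type*} (s : Finset ι) {f : ι → ℕ → ℝ}
    (h : ∀ j ∈ s, ∃ c, Tendsto (f j) atTop (𝓝 c)) :
    ∃ c, Tendsto (fun N => ∑ j ∈ s, f j N) atTop (𝓝 c) :=
  exists_tendsto_multisetSum s.val h

lemma tendsto_inv_pow (t : ℝ) (n : ℕ) :
    Tendsto (fun N : ℕ => (t / N) ^ n) atTop (𝓝 (if n = 0 then 1 else 0)) := by
  split_ifs with h
  · simp [h]
  · simpa [h] using (tendsto_const_div_atTop_nhds_zero_nat t).pow n

lemma degree_sub_single {σ : Type*} {k : σ →₀ ℕ} {s : σ} (h : Finsupp.single s 1 ≤ k) :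
    (k - Finsupp.single s 1).degree < k.degree := by
  conv_rhs => rw [← tsub_add_cancel_of_le h]
  simp

lemma coeff_scaledCorrelator_succ_cons (M : Params) {N : ℕ} (hN : N ≠ 0) {t : ℝ} (ht : 0 < t)
    (l : ℕ) (L : Multiset ℕ) (k : M.cells →₀ ℕ) :
    coeff k (M.scaledCorrelator N t ((l + 1) ::ₘ L)) =
      ∑ m ∈ Finset.range l, coeff k (M.scaledCorrelator N t (m ::ₘ (l - 1 - m) ::ₘ L)) +
      (t / N) ^ 2 * (L.map fun j : ℕ => (j : ℝ) *
        coeff k (M.scaledCorrelator N t ((l + (j - 1)) ::ₘ L.erase j))).sum +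
      ∑ C : M.cells, (t / N) ^ (2 * C.1.1) *
        if Finsupp.single C 1 ≤ k then boundaryFactor C.1.2 * (C.1.2.map fun j : ℕ => (j : ℝ) *
          coeff (k - Finsupp.single C 1)
            (M.scaledCorrelator N t ((l + (j - 1)) ::ₘ (C.1.2.erase j + L)))).sum else 0 := by
  rw [scaledCorrelator_schwinger_dyson M hN ht]
  simp only [map_add, map_sum, coeff_smul, coeff_X_mul', coeff_multiset_sum_smul]

/-- The coefficients of the normalised correlators converge as `N → ∞`.  The Schwinger–Dyson
equations express a coefficient by coefficients of lower degree in the Boltzmann weights, and by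
coefficients of the same degree for which the number of traces plus the total power is smaller. -/
lemma exists_tendsto_coeff_scaledCorrelator (M : Params) {t : ℝ} (ht : 0 < t) (k : M.cells →₀ ℕ)
    (L : Multiset ℕ) :
    ∃ c, Tendsto (fun N => coeff k (M.scaledCorrelator N t L)) atTop (𝓝 c) := by
  induction hn : k.degree using Nat.strong_induction_on generalizing k L with
  | _ n ihn =>
  induction hr : L.sum + L.card using Nat.strong_induction_on generalizing L with
  | _ r ihr =>
  rcases L.empty_or_exists_mem with rfl | ⟨a, ha⟩
  · refine ⟨_, tendsto_const_nhds.congr' (f₁ := fun _ => coeff k 1) ?_⟩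
    filter_upwards [eventually_ne_atTop 0] with N hN
    rw [scaledCorrelator_empty M hN ht]
  obtain ⟨L, rfl⟩ := Multiset.exists_cons_of_mem ha
  simp only [Multiset.sum_cons, Multiset.card_cons] at hr
  rcases a with _ | l
  · obtain ⟨c, hc⟩ := ihr _ (by omega) L rfl
    refine ⟨t * c, (hc.const_mul t).congr' ?_⟩
    filter_upwards [eventually_ne_atTop 0] with N hN
    rw [scaledCorrelator_zero_cons M hN, coeff_smul]
  · obtain ⟨c₁, h₁⟩ := exists_tendsto_finsetSum (Finset.range l)
      (f := fun m N => coeff k (M.scaledCorrelator N t (m ::ₘ (l - 1 - m) ::ₘ L)))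
      fun m hm => ihr _ (by
        have := Finset.mem_range.mp hm
        simp only [Multiset.sum_cons, Multiset.card_cons]; omega) _ rfl
    obtain ⟨c₂, h₂⟩ := exists_tendsto_multisetSum L
      (f := fun j N => (j : ℝ) *
        coeff k (M.scaledCorrelator N t ((l + (j - 1)) ::ₘ L.erase j)))
      fun j hj => by
        obtain ⟨c, hc⟩ := ihr (((l + (j - 1)) ::ₘ L.erase j).sum +
          ((l + (j - 1)) ::ₘ L.erase j).card) (by
            have h1 := Multiset.sum_erase hj
            have h2 := Multiset.card_erase_add_one hj
            simp only [Multiset.sum_cons, Multiset.card_cons]; omega) _ rfl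
        exact ⟨_, hc.const_mul _⟩
    obtain ⟨c₃, h₃⟩ := exists_tendsto_finsetSum (Finset.univ : Finset M.cells)
      (f := fun C N => (t / N) ^ (2 * C.1.1) *
        if Finsupp.single C 1 ≤ k then boundaryFactor C.1.2 * (C.1.2.map fun j : ℕ => (j : ℝ) *
          coeff (k - Finsupp.single C 1)
            (M.scaledCorrelator N t ((l + (j - 1)) ::ₘ (C.1.2.erase j + L)))).sum else 0)
      fun C _ => by
        by_cases hC : Finsupp.single C 1 ≤ k
        · obtain ⟨c, hc⟩ := exists_tendsto_multisetSum C.1.2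
            (f := fun j N => (j : ℝ) * coeff (k - Finsupp.single C 1)
              (M.scaledCorrelator N t ((l + (j - 1)) ::ₘ (C.1.2.erase j + L))))
            fun j _ => by
              obtain ⟨c, hc⟩ := ihn _ (hn ▸ degree_sub_single hC) (k - Finsupp.single C 1)
                ((l + (j - 1)) ::ₘ (C.1.2.erase j + L)) rfl
              exact ⟨_, hc.const_mul _⟩
          simp only [if_pos hC]
          exact ⟨_, (tendsto_inv_pow t _).mul (hc.const_mul _)⟩
        · simp only [if_neg hC, mul_zero]
          exact ⟨0, tendsto_const_nhds⟩
    refine ⟨_, ((h₁.add ((tendsto_inv_pow t 2).mul h₂)).add h₃).congr' ?_⟩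
    filter_upwards [eventually_ne_atTop 0] with N hN
    rw [coeff_scaledCorrelator_succ_cons M hN ht]

/-- The large-`N` limit of the normalised correlators. -/
def Params.planarSeries (M : Params) (t : ℝ) (L : Multiset ℕ) : MvPowerSeries M.cells ℝ :=
  fun k => limUnder atTop fun N => coeff k (M.scaledCorrelator N t L)

lemma tendsto_coeff_scaledCorrelator (M : Params) {t : ℝ} (ht : 0 < t) (k : M.cells →₀ ℕ)
    (L : Multiset ℕ) :
    Tendsto (fun N => coeff k (M.scaledCorrelator N t L)) atTop
      (𝓝 (coeff k (M.planarSeries t L))) :=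
  tendsto_nhds_limUnder (exists_tendsto_coeff_scaledCorrelator M ht k L)

lemma planarCoeff_eq (M : Params) (t : ℝ) (l : ℕ) (k : M.cells →₀ ℕ) :
    M.planarCoeff t l k = coeff k (M.planarSeries t {l}) := by
  rw [Params.planarCoeff, coeff_apply, Params.planarSeries]
  simp only [scaledCorrelator_singleton, coeff_smul]

lemma planarSeries_empty (M : Params) {t : ℝ} (ht : 0 < t) : M.planarSeries t 0 = 1 := by
  ext k
  refine tendsto_nhds_unique (tendsto_coeff_scaledCorrelator M ht k 0)
    (tendsto_const_nhds.congr' ?_)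
  filter_upwards [eventually_ne_atTop 0] with N hN
  rw [scaledCorrelator_empty M hN ht]

lemma planarSeries_zero_cons (M : Params) {t : ℝ} (ht : 0 < t) (L : Multiset ℕ) :
    M.planarSeries t (0 ::ₘ L) = t • M.planarSeries t L := by
  ext k
  rw [coeff_smul]
  refine tendsto_nhds_unique (tendsto_coeff_scaledCorrelator M ht k _)
    (((tendsto_coeff_scaledCorrelator M ht k L).const_mul t).congr' ?_)
  filter_upwards [eventually_ne_atTop 0] with N hN
  rw [scaledCorrelator_zero_cons M hN, coeff_smul]

/-- The planar loop equations: only the cells of genus zero survive in the limit. -/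
lemma planarSeries_succ_cons (M : Params) {t : ℝ} (ht : 0 < t) (l : ℕ) (L : Multiset ℕ) :
    M.planarSeries t ((l + 1) ::ₘ L) =
      ∑ m ∈ Finset.range l, M.planarSeries t (m ::ₘ (l - 1 - m) ::ₘ L) +
      ∑ C : M.cells, if C.1.1 = 0 then X C * (boundaryFactor C.1.2 •
        (C.1.2.map fun j : ℕ => (j : ℝ) •
          M.planarSeries t ((l + (j - 1)) ::ₘ (C.1.2.erase j + L))).sum) else 0 := by
  ext k
  refine tendsto_nhds_unique (tendsto_coeff_scaledCorrelator M ht k _) ?_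
  have hlim := fun k L => tendsto_coeff_scaledCorrelator M ht k L
  have h₁ := tendsto_finsetSum (Finset.range l)
    fun m _ => hlim k (m ::ₘ (l - 1 - m) ::ₘ L)
  have h₂ := (tendsto_inv_pow t 2).mul (tendsto_multiset_sum L
    fun j _ => (hlim k ((l + (j - 1)) ::ₘ L.erase j)).const_mul (j : ℝ))
  have h₃ := tendsto_finsetSum (Finset.univ : Finset M.cells)
    (f := fun C (N : ℕ) => (t / N) ^ (2 * C.1.1) *
      if Finsupp.single C 1 ≤ k then boundaryFactor C.1.2 * (C.1.2.map fun j : ℕ => (j : ℝ) *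
        coeff (k - Finsupp.single C 1)
          (M.scaledCorrelator N t ((l + (j - 1)) ::ₘ (C.1.2.erase j + L)))).sum else 0)
    (a := fun C => (if 2 * C.1.1 = 0 then 1 else 0) *
      if Finsupp.single C 1 ≤ k then boundaryFactor C.1.2 * (C.1.2.map fun j : ℕ => (j : ℝ) *
        coeff (k - Finsupp.single C 1)
          (M.planarSeries t ((l + (j - 1)) ::ₘ (C.1.2.erase j + L)))).sum else 0)
    fun C _ => by
      refine (tendsto_inv_pow t _).mul ?_
      split_ifs
      · exact (tendsto_multiset_sum C.1.2 fun j _ => (hlim _ _).const_mul (j : ℝ)).const_mul _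
      · exact tendsto_const_nhds
  have h := (h₁.add h₂).add h₃
  refine (h.congr' ?_).trans (le_of_eq ?_)
  · filter_upwards [eventually_ne_atTop 0] with N hN
    rw [coeff_scaledCorrelator_succ_cons M hN ht]
  · congr 1
    rw [map_add, map_sum, map_sum]
    simp only [OfNat.ofNat_ne_zero, if_false, zero_mul, add_zero]
    congr 1
    refine Finset.sum_congr rfl fun C _ => ?_
    by_cases hC : C.1.1 = 0
    · simp only [hC, mul_zero, if_true, one_mul, coeff_X_mul', coeff_smul,
        coeff_multiset_sum_smul]
    · simp [hC]

/-- Planar correlators factorise at large `N`: without the term that merges two traces, the loop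
equations for `A + B` are those for `A`, with `B` as a spectator. -/
lemma planarSeries_add (M : Params) {t : ℝ} (ht : 0 < t) (A B : Multiset ℕ) :
    M.planarSeries t (A + B) = M.planarSeries t A * M.planarSeries t B := by
  ext k
  induction hn : k.degree using Nat.strong_induction_on generalizing k A with
  | _ n ihn =>
  induction hr : A.sum + A.card using Nat.strong_induction_on generalizing A with
  | _ r ihr =>
  rcases A.empty_or_exists_mem with rfl | ⟨a, ha⟩
  · rw [planarSeries_empty M ht, zero_add, one_mul]
  obtain ⟨A, rfl⟩ := Multiset.exists_cons_of_mem ha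
  simp only [Multiset.sum_cons, Multiset.card_cons] at hr
  rcases a with _ | l
  · rw [Multiset.cons_add, planarSeries_zero_cons M ht, planarSeries_zero_cons M ht,
      smul_mul_assoc, coeff_smul, coeff_smul, ihr _ (by omega) A rfl]
  · rw [Multiset.cons_add, planarSeries_succ_cons M ht, planarSeries_succ_cons M ht, add_mul,
      map_add, map_add, Finset.sum_mul, Finset.sum_mul, map_sum, map_sum, map_sum, map_sum]
    congr 1
    · refine Finset.sum_congr rfl fun m hm => ?_
      have := Finset.mem_range.mp hm
      rw [← Multiset.cons_add, ← Multiset.cons_add]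
      exact ihr _ (by simp only [Multiset.sum_cons, Multiset.card_cons]; omega) _ rfl
    · refine Finset.sum_congr rfl fun C _ => ?_
      split_ifs
      · rw [mul_assoc, coeff_X_mul', coeff_X_mul']
        split_ifs with hC
        · rw [smul_mul_assoc, ← Multiset.sum_map_mul_right]
          simp only [smul_mul_assoc, coeff_smul, coeff_multiset_sum_smul]
          congr 2
          refine Multiset.map_congr rfl fun j _ => ?_
          rw [← add_assoc, ← Multiset.cons_add]
          rw [ihn _ (hn ▸ degree_sub_single hC) _ _ rfl]
        · rfl
      · simp

end PlanarLimit

/-! ### Numerical values of the planar series -/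

section NumericalValues

open MvPowerSeries

/-- Every cell carries a positive power of `t`, so that only finitely many monomials in the Boltzmann
weights contribute to a given power. -/
lemma cellDegree_pos (M : Params) (C : M.cells) : 0 < cellDegree C.1 := by
  obtain ⟨C, hC⟩ := C
  simp only [cellDegree, eulerChar]
  simp only [Params.cells, Finset.mem_union, diskCells, cylinderCells, cylinderIndex,
    Params.stableCells, Finset.mem_image, Finset.mem_biUnion, Finset.mem_filter,
    Finset.mem_product, Finset.mem_Icc] at hC
  rcases hC with (⟨l, hl, rfl⟩ | ⟨l, hl, rfl⟩) | ⟨n, hn, m, hm, rfl⟩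
  · simp; omega
  · simp; omega
  · have := Multiset.card_pos.mpr (M.αhat_supp n hn).1
    have h0 : (0 : ℤ) ≤ ((perimeters m).sum : ℕ) := by positivity
    simp only
    omega

/-- The Boltzmann weight `t_C` is replaced by its value times `T ^ cellDegree C`, where the
auxiliary variable `T` keeps track of the power of `t`. -/
def Params.gradedWeight (M : Params) (t : ℝ) (C : M.cells) : MvPowerSeries Unit ℝ :=
  monomial (Finsupp.single () (cellDegree C.1)) (M.weight t C.1)

lemma hasSubst_gradedWeight (M : Params) (t : ℝ) : HasSubst (M.gradedWeight t) := by
  classical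
  refine hasSubst_of_constantCoeff_zero fun C => ?_
  rw [← coeff_zero_eq_constantCoeff_apply, Params.gradedWeight, coeff_monomial, if_neg]
  intro h
  have := DFunLike.congr_fun h ()
  simp [(cellDegree_pos M C).ne] at this

/-- The sum of the terms of degree `e` of a series in the Boltzmann weights, evaluated at the
actual Boltzmann weights. -/
def Params.gradedTerm (M : Params) (t : ℝ) (f : MvPowerSeries M.cells ℝ) (e : ℕ) : ℝ :=
  coeff (Finsupp.single () e) (subst (M.gradedWeight t) f)

lemma gradedWeight_prod (M : Params) (t : ℝ) (k : M.cells →₀ ℕ) :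
    (k.prod fun C n => M.gradedWeight t C ^ n) =
      monomial (Finsupp.single () (M.tDegree k)) (k.prod fun C n => M.weight t C.1 ^ n) := by
  simp only [Params.gradedWeight, monomial_pow, Finsupp.prod, Params.tDegree, Finsupp.sum]
  rw [prod_monomial]
  congr 1
  simp [Finsupp.single_finsetSum]

/-- The substitution of `gradedWeight` collects exactly the monomials `k` with `tDegree k = e`. -/
lemma planarTerm_eq (M : Params) (t : ℝ) (l e : ℕ) :
    M.planarTerm t l e = M.gradedTerm t (M.planarSeries t {l}) e := by
  classical
  rw [Params.gradedTerm, coeff_subst (hasSubst_gradedWeight M t), Params.planarTerm]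
  refine finsum_congr fun k => ?_
  rw [gradedWeight_prod, coeff_monomial, planarCoeff_eq, smul_eq_mul]
  by_cases h : M.tDegree k = e
  · simp [h]
  · have : Finsupp.single () e ≠ Finsupp.single () (M.tDegree k) := fun h' =>
      h (by simpa using (DFunLike.congr_fun h' ()).symm)
    simp [h, this]

/-- A series in the Boltzmann weights, its terms collected by the power of `t`, converges to `v`. -/
def Params.HasValue (M : Params) (t : ℝ) (f : MvPowerSeries M.cells ℝ) (v : ℝ) : Prop :=
  HasSum (M.gradedTerm t f) v

namespace Params.HasValue

variable {M : Params} {t : ℝ} {f g : MvPowerSeries M.cells ℝ} {v w : ℝ}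

lemma add (hf : M.HasValue t f v) (hg : M.HasValue t g w) : M.HasValue t (f + g) (v + w) := by
  have : M.gradedTerm t (f + g) = fun e => M.gradedTerm t f e + M.gradedTerm t g e := by
    ext e
    rw [gradedTerm, subst_add (hasSubst_gradedWeight M t), map_add]
    rfl
  rw [HasValue, this]
  exact HasSum.add hf hg

lemma smul (c : ℝ) (hf : M.HasValue t f v) : M.HasValue t (c • f) (c * v) := by
  have : M.gradedTerm t (c • f) = fun e => c * M.gradedTerm t f e := by
    ext e
    rw [gradedTerm, subst_smul (hasSubst_gradedWeight M t), coeff_smul]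
    rfl
  rw [HasValue, this]
  exact HasSum.mul_left c hf

lemma monomial (k : M.cells →₀ ℕ) :
    M.HasValue t (MvPowerSeries.monomial k 1) (k.prod fun C n => M.weight t C.1 ^ n) := by
  classical
  have : M.gradedTerm t (MvPowerSeries.monomial k 1) =
      fun e => if e = M.tDegree k then k.prod fun C n => M.weight t C.1 ^ n else 0 := by
    ext e
    rw [gradedTerm, subst_monomial (hasSubst_gradedWeight M t), gradedWeight_prod, map_one,
      one_mul, coeff_monomial]
    simp only [(Finsupp.single_injective ()).eq_iff]
  rw [HasValue, this]
  exact hasSum_ite_eq _ _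

lemma one : M.HasValue t 1 1 := by
  have h := monomial (M := M) (t := t) 0
  rwa [MvPowerSeries.monomial_zero_one, Finsupp.prod_zero_index] at h

lemma zero : M.HasValue t 0 0 := by
  simpa only [zero_smul, zero_mul] using one (M := M) (t := t) |>.smul 0

lemma X (C : M.cells) : M.HasValue t (MvPowerSeries.X C) (M.weight t C.1) := by
  simpa [MvPowerSeries.X] using monomial (M := M) (t := t) (Finsupp.single C 1)

lemma mul (hf : M.HasValue t f v) (hg : M.HasValue t g w) : M.HasValue t (f * g) (v * w) := by
  have : M.gradedTerm t (f * g) = fun e => ∑ ij ∈ Finset.HasAntidiagonal.antidiagonal e,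
      M.gradedTerm t f ij.1 * M.gradedTerm t g ij.2 := by
    ext e
    rw [gradedTerm, subst_mul (hasSubst_gradedWeight M t)]
    exact PowerSeries.coeff_mul e (subst (M.gradedWeight t) f : PowerSeries ℝ)
      (subst (M.gradedWeight t) g)
  rw [HasValue] at hf hg ⊢
  -- a convergent `HasSum` of real numbers is absolutely convergent
  have hf' := hf.summable.norm
  have hg' := hg.summable.norm
  rw [this, ← hf.tsum_eq, ← hg.tsum_eq,
    tsum_mul_tsum_eq_tsum_sum_antidiagonal_of_summable_norm hf' hg']
  exact (summable_norm_sum_mul_antidiagonal_of_summable_norm hf' hg').of_norm.hasSum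

lemma unique (hf : M.HasValue t f v) (hg : M.HasValue t f w) : v = w := HasSum.unique hf hg

lemma sum {ι : Type*} {s : Finset ι} {f : ι → MvPowerSeries M.cells ℝ} {v : ι → ℝ}
    (h : ∀ i ∈ s, M.HasValue t (f i) (v i)) : M.HasValue t (∑ i ∈ s, f i) (∑ i ∈ s, v i) := by
  classical
  induction s using Finset.induction_on with
  | empty => simpa using zero
  | insert a s ha ih =>
    rw [Finset.sum_insert ha, Finset.sum_insert ha]
    exact (h a (by simp)).add (ih fun i hi => h i (by simp [hi]))

lemma multisetSum {ι : Type*} {s : Multiset ι} {f : ι → MvPowerSeries M.cells ℝ} {v : ι → ℝ}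
    (h : ∀ i ∈ s, M.HasValue t (f i) (v i)) :
    M.HasValue t (s.map f).sum (s.map v).sum := by
  induction s using Multiset.induction with
  | empty => simpa using zero
  | cons a s ih => simpa using (h a (by simp)).add (ih fun i hi => h i (by simp [hi]))

end Params.HasValue

/-- The numerical value of a planar correlator is the product of the planar moments. -/
lemma hasValue_planarSeries (M : Params) {t : ℝ} (ht : 0 < t)
    (hs : ∀ l, Summable (M.planarTerm t l)) (L : Multiset ℕ) :
    M.HasValue t (M.planarSeries t L) (L.map (M.planarMoment t)).prod := by
  induction L using Multiset.induction with
  | empty => simpa [planarSeries_empty M ht] using Params.HasValue.one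
  | cons a L ih =>
    rw [← Multiset.singleton_add, planarSeries_add M ht, Multiset.map_add, Multiset.prod_add]
    refine Params.HasValue.mul ?_ ih
    rw [Multiset.map_singleton, Multiset.prod_singleton, Params.HasValue, Params.planarMoment]
    have : M.gradedTerm t (M.planarSeries t {a}) = M.planarTerm t a :=
      funext fun e => (planarTerm_eq M t a e).symm
    rw [this]
    exact (hs a).hasSum

lemma planarMoment_zero (M : Params) {t : ℝ} (ht : 0 < t)
    (hs : ∀ l, Summable (M.planarTerm t l)) : M.planarMoment t 0 = t := by
  have h1 := hasValue_planarSeries M ht hs (0 ::ₘ 0)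
  rw [planarSeries_zero_cons M ht, planarSeries_empty M ht] at h1
  simpa using h1.unique (Params.HasValue.one.smul t)

/-- The cells of genus zero are the disks and the cylinders, listed without repetition. -/
lemma sum_planar_cells (M : Params) (f : Cell → ℝ) :
    ∑ C : M.cells, (if C.1.1 = 0 then f C.1 else 0) =
      ∑ l ∈ Finset.Icc 3 M.d, f (0, {l}) + ∑ l ∈ cylinderIndex M.d, f (0, {l.1, l.2}) := by
  classical
  have d1 : Disjoint (diskCells M.d) (cylinderCells M.d) := by
    rw [Finset.disjoint_left]
    intro C h1 h2
    simp only [diskCells, cylinderCells, Finset.mem_image] at h1 h2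
    obtain ⟨l, _, rfl⟩ := h1
    obtain ⟨p, _, hp⟩ := h2
    have := congrArg Multiset.card (Prod.ext_iff.mp hp).2
    simp at this
  have hcells : M.cells.filter (fun C => C.1 = 0) = diskCells M.d ∪ cylinderCells M.d := by
    ext C
    simp only [Params.cells, Params.stableCells, diskCells, cylinderCells, Finset.mem_filter,
      Finset.mem_union, Finset.mem_image, Finset.mem_biUnion]
    constructor
    · rintro ⟨h | ⟨n, _, m, _, rfl⟩, h0⟩
      · exact h
      · simp at h0
    · intro h
      refine ⟨Or.inl h, ?_⟩
      rcases h with ⟨l, _, rfl⟩ | ⟨l, _, rfl⟩ <;> rfl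
  rw [Finset.sum_coe_sort M.cells (fun C => if C.1 = 0 then f C else 0), ← Finset.sum_filter,
    hcells, Finset.sum_union d1, diskCells, cylinderCells, Finset.sum_image, Finset.sum_image]
  · rintro ⟨a, b⟩ h1 ⟨c, d⟩ h2 h
    simp only [cylinderIndex, Finset.coe_filter, Set.mem_ofPred_eq] at h1 h2
    simp only [Prod.mk.injEq, true_and] at h
    have hs := congrArg Multiset.sum h
    have hm : a ∈ ({c, d} : Multiset ℕ) := h ▸ (by simp)
    simp only [Multiset.insert_eq_cons, Multiset.sum_cons, Multiset.sum_singleton,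
      Multiset.mem_cons, Multiset.mem_singleton] at hs hm
    rw [Prod.mk.injEq]
    omega
  · intro a _ b _ h
    simpa using h

/-- The planar loop equations for the moments. -/
lemma planarMoment_succ (M : Params) {t : ℝ} (ht : 0 < t)
    (hs : ∀ l, Summable (M.planarTerm t l)) (l : ℕ) :
    M.planarMoment t (l + 1) =
      ∑ i ∈ Finset.range l, M.planarMoment t i * M.planarMoment t (l - 1 - i) +
      ∑ n ∈ Finset.Icc 3 M.d, M.weight t (0, {n}) * M.planarMoment t (l + (n - 1)) +
      ∑ p ∈ cylinderIndex M.d, M.weight t (0, {p.1, p.2}) * (1 / 2 *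
        (M.planarMoment t p.2 / p.2 * M.planarMoment t (l + (p.1 - 1)) +
          M.planarMoment t p.1 / p.1 * M.planarMoment t (l + (p.2 - 1)))) := by
  have hv := hasValue_planarSeries M ht hs
  have h1 := hv ((l + 1) ::ₘ 0)
  rw [planarSeries_succ_cons M ht] at h1
  have hC : ∀ C : M.cells, M.HasValue t
      (if C.1.1 = 0 then X C * (boundaryFactor C.1.2 • (C.1.2.map fun j : ℕ => (j : ℝ) •
        M.planarSeries t ((l + (j - 1)) ::ₘ (C.1.2.erase j + 0))).sum) else 0)
      (if C.1.1 = 0 then M.weight t C.1 * (boundaryFactor C.1.2 * (C.1.2.map fun j : ℕ =>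
        (j : ℝ) * (((l + (j - 1)) ::ₘ (C.1.2.erase j + 0)).map (M.planarMoment t)).prod).sum)
        else 0) := by
    intro C
    split_ifs
    · refine (Params.HasValue.X C).mul (Params.HasValue.smul _ ?_)
      exact Params.HasValue.multisetSum (s := C.1.2)
        (f := fun j : ℕ => (j : ℝ) • M.planarSeries t ((l + (j - 1)) ::ₘ (C.1.2.erase j + 0)))
        (v := fun j : ℕ => (j : ℝ) *
          (((l + (j - 1)) ::ₘ (C.1.2.erase j + 0)).map (M.planarMoment t)).prod)
        fun j _ => (hv _).smul (j : ℝ)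
    · exact Params.HasValue.zero
  have h2 := Params.HasValue.add
    (Params.HasValue.sum (s := Finset.range l) fun m _ => hv (m ::ₘ (l - 1 - m) ::ₘ 0))
    (Params.HasValue.sum (s := Finset.univ) fun C _ => hC C)
  have h3 := h1.unique h2
  rw [sum_planar_cells M (fun C => M.weight t C * (boundaryFactor C.2 *
    (C.2.map fun j : ℕ => (j : ℝ) *
      (((l + (j - 1)) ::ₘ (C.2.erase j + 0)).map (M.planarMoment t)).prod).sum))] at h3
  simp only [Multiset.map_cons, Multiset.prod_cons, Multiset.map_zero, Multiset.prod_zero,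
    mul_one] at h3
  rw [h3, ← add_assoc]
  congr 1
  · congr 1
    refine Finset.sum_congr rfl fun n hn => ?_
    have : (n : ℝ) ≠ 0 := by
      have := (Finset.mem_Icc.mp hn).1
      positivity
    refine congrArg (M.weight t (0, {n}) * ·) ?_
    simp [boundaryFactor]
    field_simp
  · refine Finset.sum_congr rfl fun p hp => ?_
    simp only [cylinderIndex, Finset.mem_filter, Finset.mem_product, Finset.mem_Icc] at hp
    have h1 : (p.1 : ℝ) ≠ 0 := by
      have := hp.1.1.1
      positivity
    have h2 : (p.2 : ℝ) ≠ 0 := by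
      have := hp.1.2.1
      positivity
    have e : (p.1 ::ₘ {p.2} : Multiset ℕ).erase p.2 = {p.1} := by
      rw [← Multiset.insert_eq_cons, Multiset.pair_comm]; simp
    refine congrArg (M.weight t (0, {p.1, p.2}) * ·) ?_
    simp [boundaryFactor, e]
    field_simp

end NumericalValues

/-! ### The quadratic equation for the generating function of the moments -/

section QuadraticEquation

open Filter Polynomial

lemma aeval_momentPoly_succ (m : ℕ → ℝ) (j : ℕ) (x : ℂ) :
    aeval x (momentPoly m (j + 1)) = ∑ n ∈ Finset.range j, (m n : ℂ) * x ^ (j - 1 - n) := by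
  rw [← Finset.sum_range_reflect]
  simp only [momentPoly, Nat.add_sub_cancel, map_sum, map_mul, map_pow, aeval_X, aeval_C]
  refine Finset.sum_congr rfl fun n hn => ?_
  have := Finset.mem_range.mp hn
  rw [show j - 1 - (j - 1 - n) = n by omega, show j + 1 - 2 - n = j - 1 - n by omega]
  rfl

/-- Subtracting from `x ^ j * w` its polynomial part at infinity shifts the coefficients. -/
lemma hasSum_laurent_tail {m : ℕ → ℝ} {x w : ℂ} (hx : x ≠ 0)
    (h : HasSum (fun l : ℕ => (m l : ℂ) / x ^ (l + 1)) w) (j : ℕ) :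
    HasSum (fun l : ℕ => (m (l + j) : ℂ) / x ^ (l + 1))
      (x ^ j * w - aeval x (momentPoly m (j + 1))) := by
  have h1 := ((hasSum_nat_add_iff' j).mpr h).mul_left (x ^ j)
  have e : x ^ j * (w - ∑ n ∈ Finset.range j, (m n : ℂ) / x ^ (n + 1)) =
      x ^ j * w - aeval x (momentPoly m (j + 1)) := by
    rw [mul_sub, aeval_momentPoly_succ, Finset.mul_sum]
    congr 1
    refine Finset.sum_congr rfl fun n hn => ?_
    have := Finset.mem_range.mp hn
    rw [show x ^ j = x ^ (j - 1 - n) * x ^ (n + 1) by rw [← pow_add]; congr 1; omega]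
    field_simp
  rw [e] at h1
  refine h1.congr_fun fun l => ?_
  rw [show l + j + 1 = j + (l + 1) by ring, pow_add x j]
  field_simp

lemma hasSum_laurent_sq {m : ℕ → ℝ} {x w : ℂ}
    (h : HasSum (fun l : ℕ => (m l : ℂ) / x ^ (l + 1)) w) :
    HasSum (fun l : ℕ => ((∑ i ∈ Finset.range l, m i * m (l - 1 - i) : ℝ) : ℂ) / x ^ (l + 1))
      (w ^ 2) := by
  rw [← hasSum_nat_add_iff' 1]
  have h1 := hasSum_sum_range_mul_of_summable_norm h.summable.norm h.summable.norm
  rw [h.tsum_eq] at h1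
  simp only [Finset.sum_range_one, Finset.range_zero, Finset.sum_empty, Complex.ofReal_zero,
    zero_div, sub_zero]
  rw [pow_two]
  refine h1.congr_fun fun n => ?_
  push_cast
  rw [Finset.sum_div]
  refine Finset.sum_congr rfl fun i hi => ?_
  have := Finset.mem_range.mp hi
  rw [div_mul_div_comm, ← pow_add]
  congr 2
  omega

lemma aeval_polyQ (M : Params) (t : ℝ) (m : ℕ → ℝ) (x : ℂ) :
    aeval x (M.polyQ t m) = -x + ∑ n ∈ Finset.Icc 3 M.d, (M.weight t (0, {n}) : ℂ) * x ^ (n - 1) +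
      ∑ p ∈ cylinderIndex M.d, (M.weight t (0, {p.1, p.2}) : ℂ) * (1 / 2 *
        ((m p.2 / p.2 : ℂ) * x ^ (p.1 - 1) + (m p.1 / p.1 : ℂ) * x ^ (p.2 - 1))) := by
  simp only [Params.polyQ, map_add, map_neg, map_sum, map_mul, map_pow, aeval_X, aeval_C,
    Finset.mul_sum]
  congr 1
  refine Finset.sum_congr rfl fun p _ => ?_
  simp only [Complex.coe_algebraMap]
  push_cast
  ring

lemma aeval_polyP (M : Params) (t : ℝ) (m : ℕ → ℝ) (x : ℂ) :
    aeval x (M.polyP t m) = t -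
      ∑ n ∈ Finset.Icc 3 M.d, (M.weight t (0, {n}) : ℂ) * aeval x (momentPoly m n) -
      ∑ p ∈ cylinderIndex M.d, (M.weight t (0, {p.1, p.2}) : ℂ) * (1 / 2 *
        ((m p.2 / p.2 : ℂ) * aeval x (momentPoly m p.1) +
          (m p.1 / p.1 : ℂ) * aeval x (momentPoly m p.2))) := by
  simp only [Params.polyP, map_sub, map_add, map_sum, map_mul, aeval_C, Finset.mul_sum]
  congr 1
  refine Finset.sum_congr rfl fun p _ => ?_
  simp only [Complex.coe_algebraMap]
  push_cast
  ring

/-- Multiplying the loop equation for `m (l + 1)` by `x ^ (-(l + 1))` and summing over `l` gives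
the quadratic equation. -/
lemma quadratic_of_hasSum (M : Params) {t : ℝ} (ht : 0 < t)
    (hs : ∀ l, Summable (M.planarTerm t l)) {x w : ℂ} (hx : x ≠ 0)
    (h : HasSum (fun l : ℕ => (M.planarMoment t l : ℂ) / x ^ (l + 1)) w) :
    w ^ 2 + aeval x (M.polyQ t (M.planarMoment t)) * w
      + aeval x (M.polyP t (M.planarMoment t)) = 0 := by
  set m := M.planarMoment t with hm
  have hT := hasSum_laurent_tail hx h
  have h1 := hT 1
  have h2 : HasSum _ _ := ((hasSum_laurent_sq h).add
    (hasSum_sum (s := Finset.Icc 3 M.d) fun n _ =>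
      (hT (n - 1)).mul_left (M.weight t (0, {n}) : ℂ))).add
    (hasSum_sum (s := cylinderIndex M.d) fun p _ =>
      ((((hT (p.1 - 1)).mul_left (m p.2 / p.2 : ℂ)).add
        ((hT (p.2 - 1)).mul_left (m p.1 / p.1 : ℂ))).mul_left (1 / 2 : ℂ)).mul_left
          (M.weight t (0, {p.1, p.2}) : ℂ))
  have h3 := h1.unique (h2.congr_fun fun l => ?_)
  · have e0 : aeval x (momentPoly m (1 + 1)) = t := by
      rw [aeval_momentPoly_succ]
      simp [hm, planarMoment_zero M ht hs]
    have en : ∀ n ∈ Finset.Icc 3 M.d, n - 1 + 1 = n := fun n hn => by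
      have := (Finset.mem_Icc.mp hn).1
      omega
    have ep : ∀ p ∈ cylinderIndex M.d, p.1 - 1 + 1 = p.1 ∧ p.2 - 1 + 1 = p.2 := fun p hp => by
      simp only [cylinderIndex, Finset.mem_filter, Finset.mem_product, Finset.mem_Icc] at hp
      omega
    rw [e0, Finset.sum_congr rfl fun n hn => by rw [en n hn],
      Finset.sum_congr (s₁ := cylinderIndex M.d) rfl fun p hp => by
        rw [(ep p hp).1, (ep p hp).2]] at h3
    rw [aeval_polyQ, aeval_polyP]
    simp only [mul_sub, mul_add, Finset.sum_add_distrib, Finset.sum_sub_distrib, pow_one] at h3 ⊢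
    simp only [add_mul, Finset.sum_mul] at h3 ⊢
    simp only [mul_assoc] at h3 ⊢
    linear_combination -h3
  · rw [show m (l + 1) = _ from planarMoment_succ M ht hs l, ← hm]
    push_cast
    simp only [add_div, Finset.sum_div]
    congr 1
    · congr 1
      refine Finset.sum_congr rfl fun n _ => ?_
      ring
    · refine Finset.sum_congr rfl fun p _ => ?_
      ring

lemma isClosed_cut (a b : ℝ) : IsClosed (cut a b) :=
  (isCompact_Icc.image Complex.continuous_ofReal).isClosed

lemma mem_cut {a b : ℝ} {x : ℂ} : x ∈ cut a b ↔ x.im = 0 ∧ a ≤ x.re ∧ x.re ≤ b := by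
  constructor
  · rintro ⟨s, hs, rfl⟩
    simpa using hs
  · rintro ⟨h0, h⟩
    exact ⟨x.re, h, by apply Complex.ext <;> simp [h0]⟩

lemma isPreconnected_compl_cut (a b : ℝ) : IsPreconnected (cut a b)ᶜ := by
  have e : (cut a b)ᶜ = (({x : ℂ | 0 < x.im} ∪ {x : ℂ | x.re < a}) ∪ {x : ℂ | x.im < 0}) ∪
      {x : ℂ | b < x.re} := by
    ext x
    simp only [Set.mem_compl_iff, mem_cut, Set.mem_union, Set.mem_ofPred_eq]
    grind
  rw [e]
  -- a union of overlapping half-planes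
  refine IsPreconnected.union ⟨b + 1, 1⟩ (Or.inl (Or.inl (by simp))) (by simp)
    (IsPreconnected.union ⟨a - 1, -1⟩ (Or.inr (by simp)) (by simp)
      (IsPreconnected.union ⟨a - 1, 1⟩ (by simp) (by simp) ?_ ?_) ?_) ?_
  · exact (convex_halfSpace_im_gt 0).isPreconnected
  · exact (convex_halfSpace_re_lt a).isPreconnected
  · exact (convex_halfSpace_im_lt 0).isPreconnected
  · exact (convex_halfSpace_re_gt b).isPreconnected

/-- The quadratic equation extends from a neighbourhood of infinity by the identity theorem. -/
lemma quadratic_compl_cut {M : Params} {t : ℝ} (ht : 0 < t) {W : ℂ → ℂ} {a b : ℝ} {φ : ℝ → ℝ}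
    (hφ : M.IsSpectralDensity t W a b φ) {x : ℂ} (hx : x ∉ cut a b) :
    W x ^ 2 + aeval x (M.polyQ t (M.planarMoment t)) * W x
      + aeval x (M.polyP t (M.planarMoment t)) = 0 := by
  have hd : ∀ P : ℝ[X], Differentiable ℂ fun x : ℂ => aeval x P := fun P => by
    simp only [← eval_map_algebraMap]
    exact (P.map (algebraMap ℝ ℂ)).differentiable
  have hA : AnalyticOnNhd ℂ (fun x => W x ^ 2 + aeval x (M.polyQ t (M.planarMoment t)) * W x
      + aeval x (M.polyP t (M.planarMoment t))) (cut a b)ᶜ := by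
    refine DifferentiableOn.analyticOnNhd ?_ (isClosed_cut a b).isOpen_compl
    exact ((hφ.holomorphic.pow 2).add ((hd _).differentiableOn.mul hφ.holomorphic)).add
      (hd _).differentiableOn
  obtain ⟨R, -, hR⟩ := (Filter.hasBasis_cobounded_norm.eventually_iff).mp hφ.laurent
  -- the half-plane `r < re x` lies off the cut and in the domain of the Laurent series
  set r : ℝ := max R (max 0 b) with hr
  have hopen : IsOpen {x : ℂ | r < x.re} := isOpen_lt continuous_const Complex.continuous_re
  have hz : ((r + 1 : ℝ) : ℂ) ∈ {x : ℂ | r < x.re} := by simp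
  have hsub : ∀ x ∈ {x : ℂ | r < x.re}, R < ‖x‖ ∧ x ≠ 0 ∧ x ∉ cut a b := by
    intro x hx
    have hx : r < x.re := hx
    have h1 : R ≤ r := le_max_left _ _
    have h2 : 0 ≤ r := (le_max_left _ _).trans (le_max_right _ _)
    have h3 : b ≤ r := (le_max_right _ _).trans (le_max_right _ _)
    refine ⟨by linarith [Complex.re_le_norm x], ?_, ?_⟩
    · rintro rfl
      simp at hx
      linarith
    · rw [mem_cut]
      rintro ⟨-, -, h⟩
      linarith
  refine hA.eqOn_zero_of_preconnected_of_eventuallyEq_zero (isPreconnected_compl_cut a b)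
    (hsub _ hz).2.2 ?_ hx
  filter_upwards [hopen.mem_nhds hz] with x hx
  exact quadratic_of_hasSum M ht hφ.summable (hsub x hx).2.1 (hR (hsub x hx).1.le)

/-- `W` is bounded near the cut, including its end points: a root of `y ^ 2 + Q y + P` has absolute
value at most `1 + |Q| + |P|`. -/
lemma exists_bound_of_norm_le {M : Params} {t : ℝ} (ht : 0 < t) {W : ℂ → ℂ} {a b : ℝ}
    {φ : ℝ → ℝ} (hφ : M.IsSpectralDensity t W a b φ) (R : ℝ) :
    ∃ B, ∀ x ∉ cut a b, ‖x‖ ≤ R → ‖W x‖ ≤ B := by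
  set Q := M.polyQ t (M.planarMoment t)
  set P := M.polyP t (M.planarMoment t)
  have hc : Continuous fun x : ℂ => 1 + ‖aeval x Q‖ + ‖aeval x P‖ :=
    (continuous_const.add Q.continuous_aeval.norm).add P.continuous_aeval.norm
  obtain ⟨B, hB⟩ := (isCompact_closedBall (0 : ℂ) R).exists_bound_of_continuousOn hc.continuousOn
  refine ⟨B, fun x hx hxR => ?_⟩
  have h1 := (le_abs_self _).trans (hB x (by simpa using hxR))
  refine le_trans ?_ h1
  by_contra! h
  have h2 := quadratic_compl_cut ht hφ hx
  have h3 : ‖W x‖ ^ 2 ≤ ‖aeval x Q‖ * ‖W x‖ + ‖aeval x P‖ := by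
    rw [← norm_pow, show W x ^ 2 = -(aeval x Q * W x + aeval x P) by linear_combination h2,
      norm_neg, ← norm_mul]
    exact norm_add_le _ _
  nlinarith [norm_nonneg (aeval x Q), norm_nonneg (aeval x P)]

end QuadraticEquation

/-! ### Contour integrals around the cut -/

section ContourIntegrals

open Filter MeasureTheory Complex

/-- The integral of `h` over the positively oriented boundary of the square `[-R, R]²`. -/
def squareIntegral (h : ℂ → ℂ) (R : ℝ) : ℂ :=
  (∫ x in (-R)..R, h (x - R * I)) - (∫ x in (-R)..R, h (x + R * I)) +
    I * (∫ y in (-R)..R, h (R + y * I)) - I * (∫ y in (-R)..R, h (-R + y * I))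

/-- The integral of `h` along `R ζ`, a dilated side of a square, when `h(z)` behaves like `c / z`. -/
lemma tendsto_scaled_side {h : ℂ → ℂ} {c : ℂ} {R₁ : ℝ}
    (hc : ContinuousOn h {z | R₁ ≤ ‖z‖})
    (hinf : Tendsto (fun z => z * h z) (Bornology.cobounded ℂ) (𝓝 c)) {ζ : ℝ → ℂ}
    (hζ : Continuous ζ) (hζ1 : ∀ u, 1 ≤ ‖ζ u‖) :
    Tendsto (fun R : ℝ => ∫ u in (-1 : ℝ)..1, (R : ℂ) * h (R * ζ u)) atTop
      (𝓝 (∫ u in (-1 : ℝ)..1, c * (ζ u)⁻¹)) := by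
  have hb : ∀ᶠ z in Bornology.cobounded ℂ, ‖z * h z‖ ≤ ‖c‖ + 1 :=
    (hinf.norm.eventually_lt_const (lt_add_one _)).mono fun _ h => h.le
  obtain ⟨R₀, -, hR₀⟩ := Filter.hasBasis_cobounded_norm.eventually_iff.mp hb
  have hζ0 : ∀ u, ζ u ≠ 0 := fun u h0 => by have := hζ1 u; rw [h0, norm_zero] at this; linarith
  have hbig : ∀ (R : ℝ) u, 0 ≤ R → R ≤ ‖(R : ℂ) * ζ u‖ := fun R u hR => by
    rw [norm_mul, norm_real, Real.norm_of_nonneg hR]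
    nlinarith [hζ1 u]
  have heq : ∀ (R : ℝ) u, (R : ℂ) * h (R * ζ u) = (R * ζ u) * h (R * ζ u) * (ζ u)⁻¹ := by
    intro R u
    have := hζ0 u
    field_simp
  refine intervalIntegral.tendsto_integral_filter_of_dominated_convergence
    (fun _ => ‖c‖ + 1) ?_ ?_ intervalIntegrable_const ?_
  · filter_upwards [eventually_ge_atTop R₁, eventually_ge_atTop 0] with R hR hR'
    refine (continuous_const.mul (hc.comp_continuous (continuous_const.mul hζ)
      fun u => ?_)).aestronglyMeasurable
    exact hR.trans (hbig R u hR')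
  · filter_upwards [eventually_ge_atTop R₀, eventually_ge_atTop 0] with R hR hR'
    refine Eventually.of_forall fun u _ => ?_
    have h1 := hR₀ (show (R : ℂ) * ζ u ∈ {x : ℂ | R₀ ≤ ‖x‖} from hR.trans (hbig R u hR'))
    rw [heq, norm_mul, norm_inv]
    calc _ ≤ (‖c‖ + 1) * 1 := by
          gcongr
          exact inv_le_one_of_one_le₀ (hζ1 u)
      _ = _ := mul_one _
  · refine Eventually.of_forall fun u _ => ?_
    simp only [heq]
    refine Tendsto.mul_const _ (hinf.comp ?_)
    rw [← tendsto_norm_atTop_iff_cobounded]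
    exact tendsto_atTop_mono' _ ((eventually_ge_atTop 0).mono fun R hR => hbig R u hR) tendsto_id

lemma one_le_norm_of_abs_re {z : ℂ} (h : 1 ≤ |z.re|) : 1 ≤ ‖z‖ := h.trans (abs_re_le_norm z)

lemma one_le_norm_of_abs_im {z : ℂ} (h : 1 ≤ |z.im|) : 1 ≤ ‖z‖ := h.trans (abs_im_le_norm z)

/-- If `z h(z) → c` at infinity, the integrals over large squares converge to `2πi c`. -/
lemma tendsto_squareIntegral {h : ℂ → ℂ} {c : ℂ} {R₁ : ℝ}
    (hc : ContinuousOn h {z | R₁ ≤ ‖z‖})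
    (hinf : Tendsto (fun z => z * h z) (Bornology.cobounded ℂ) (𝓝 c)) :
    Tendsto (squareIntegral h) atTop (𝓝 (2 * Real.pi * I * c)) := by
  have t1 := tendsto_scaled_side hc hinf (ζ := fun u => u - I) (by fun_prop)
    fun u => one_le_norm_of_abs_im (by simp)
  have t2 := tendsto_scaled_side hc hinf (ζ := fun u => u + I) (by fun_prop)
    fun u => one_le_norm_of_abs_im (by simp)
  have t3 := tendsto_scaled_side hc hinf (ζ := fun u => 1 + u * I) (by fun_prop)
    fun u => one_le_norm_of_abs_re (by simp)
  have t4 := tendsto_scaled_side hc hinf (ζ := fun u => -1 + u * I) (by fun_prop)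
    fun u => one_le_norm_of_abs_re (by simp)
  have n1 : ∀ u : ℝ, (u : ℂ) - I ≠ 0 := fun u h => by simpa using congrArg im h
  have n2 : ∀ u : ℝ, (u : ℂ) + I ≠ 0 := fun u h => by simpa using congrArg im h
  have n3 : ∀ u : ℝ, (1 : ℂ) + u * I ≠ 0 := fun u h => by simpa using congrArg re h
  have n4 : ∀ u : ℝ, (-1 : ℂ) + u * I ≠ 0 := fun u h => by simpa using congrArg re h
  have hval : (∫ u in (-1 : ℝ)..1, c * ((u : ℂ) - I)⁻¹) - (∫ u in (-1 : ℝ)..1, c * ((u : ℂ) + I)⁻¹)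
      + I * (∫ u in (-1 : ℝ)..1, c * ((1 : ℂ) + u * I)⁻¹)
      - I * (∫ u in (-1 : ℝ)..1, c * ((-1 : ℂ) + u * I)⁻¹) = 2 * Real.pi * I * c := by
    have i1 : IntervalIntegrable (fun u : ℝ => c * ((u : ℂ) - I)⁻¹) volume (-1) 1 :=
      (continuous_const.mul (Continuous.inv₀ (by fun_prop) n1)).intervalIntegrable _ _
    have i2 : IntervalIntegrable (fun u : ℝ => c * ((u : ℂ) + I)⁻¹) volume (-1) 1 :=
      (continuous_const.mul (Continuous.inv₀ (by fun_prop) n2)).intervalIntegrable _ _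
    have i3 : IntervalIntegrable (fun u : ℝ => I * (c * ((1 : ℂ) + u * I)⁻¹)) volume (-1) 1 :=
      (continuous_const.mul (continuous_const.mul
        (Continuous.inv₀ (by fun_prop) n3))).intervalIntegrable _ _
    have i4 : IntervalIntegrable (fun u : ℝ => I * (c * ((-1 : ℂ) + u * I)⁻¹)) volume (-1) 1 :=
      (continuous_const.mul (continuous_const.mul
        (Continuous.inv₀ (by fun_prop) n4))).intervalIntegrable _ _
    rw [← intervalIntegral.integral_const_mul, ← intervalIntegral.integral_const_mul,
      ← intervalIntegral.integral_sub i1 i2, ← intervalIntegral.integral_add (i1.sub i2) i3,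
      ← intervalIntegral.integral_sub ((i1.sub i2).add i3) i4]
    have e : ∀ u : ℝ, c * ((u : ℂ) - I)⁻¹ - c * ((u : ℂ) + I)⁻¹ + I * (c * ((1 : ℂ) + u * I)⁻¹)
        - I * (c * ((-1 : ℂ) + u * I)⁻¹) = (4 * I * c) * (((1 + u ^ 2)⁻¹ : ℝ) : ℂ) := by
      intro u
      have h1 := n1 u
      have h2 := n2 u
      have h3 : (1 : ℂ) + u ^ 2 ≠ 0 := by
        have : (1 + u ^ 2 : ℝ) ≠ 0 := by positivity
        exact_mod_cast this
      have e1 : ((u : ℂ) - I)⁻¹ = (u + I) * (1 + u ^ 2 : ℂ)⁻¹ := by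
        field_simp
        linear_combination I_sq
      have e2 : ((u : ℂ) + I)⁻¹ = (u - I) * (1 + u ^ 2 : ℂ)⁻¹ := by
        field_simp
        linear_combination I_sq
      have h4 := n3 u
      have h5 := n4 u
      have e3 : ((1 : ℂ) + u * I)⁻¹ = (1 - u * I) * (1 + u ^ 2 : ℂ)⁻¹ := by
        field_simp
        linear_combination u ^ 2 * I_sq
      have e4 : ((-1 : ℂ) + u * I)⁻¹ = (-1 - u * I) * (1 + u ^ 2 : ℂ)⁻¹ := by
        field_simp
        linear_combination u ^ 2 * I_sq
      rw [e1, e2, e3, e4]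
      push_cast
      ring
    simp only [e]
    rw [intervalIntegral.integral_const_mul, intervalIntegral.integral_ofReal,
      integral_inv_one_add_sq]
    simp only [Real.arctan_one, Real.arctan_neg]
    push_cast
    ring
  rw [← hval]
  refine (((t1.sub t2).add (t3.const_mul I)).sub (t4.const_mul I)).congr' ?_
  filter_upwards [eventually_gt_atTop 0] with R hR
  have hs : ∀ f : ℝ → ℂ, ∫ x in (-R)..R, f x = ∫ u in (-1 : ℝ)..1, (R : ℂ) * f (R * u) := by
    intro f
    have := intervalIntegral.smul_integral_comp_mul_left (a := -1) (b := 1) f R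
    rw [mul_neg, mul_one] at this
    rw [← this, intervalIntegral.integral_const_mul, real_smul]
  rw [squareIntegral, hs, hs, hs fun y => h (R + y * I), hs fun y => h (-R + y * I)]
  push_cast
  congr 1
  · congr 1
    · congr 1
      · congr 1; ext u; ring_nf
      · congr 1; ext u; ring_nf
    · congr 2; ext u; ring_nf
  · congr 2; ext u; ring_nf

/-- Cauchy's theorem for a rectangle that stays on one side of the real line. -/
lemma integral_rectangle_eq {a b : ℝ} {h : ℂ → ℂ} (hol : DifferentiableOn ℂ h (cut a b)ᶜ)
    (R y₁ y₂ : ℝ) (hy : ∀ y ∈ Set.uIcc y₁ y₂, y ≠ 0) :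
    (∫ x in (-R)..R, h (x + y₁ * I)) - (∫ x in (-R)..R, h (x + y₂ * I)) +
      I * (∫ y in y₁..y₂, h (R + y * I)) - I * (∫ y in y₁..y₂, h (-R + y * I)) = 0 := by
  have := integral_boundary_rect_eq_zero_of_differentiableOn h (-R + y₁ * I) (R + y₂ * I)
    (hol.mono fun z hz hcut => hy z.im (by simpa using hz.2) (mem_cut.mp hcut).1)
  simpa using this

/-- The discontinuity of `h` across the cut integrates to the residue at infinity.  Boundedness of `h`
excludes contributions of the end points. -/
lemma integral_jump {a b : ℝ} {h : ℂ → ℂ} {J : ℝ → ℂ} {c : ℂ}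
    (hol : DifferentiableOn ℂ h (cut a b)ᶜ)
    (bdd : ∀ R, ∃ B, ∀ z ∉ cut a b, ‖z‖ ≤ R → ‖h z‖ ≤ B)
    (jump : ∀ s ∈ Set.Ioo a b, Tendsto (fun ε : ℝ => h (s - ε * I) - h (s + ε * I)) (𝓝[>] 0)
      (𝓝 (J s)))
    (hinf : Tendsto (fun z => z * h z) (Bornology.cobounded ℂ) (𝓝 c)) :
    ∫ s in Set.Ioo a b, J s = 2 * Real.pi * I * c := by
  have hopen : IsOpen (cut a b)ᶜ := (isClosed_cut a b).isOpen_compl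
  have hcont : ContinuousOn h (cut a b)ᶜ := hol.continuousOn
  have hnorm : ∀ z ∈ cut a b, ‖z‖ < |a| + |b| + 1 := by
    rintro z ⟨s, hs, rfl⟩
    rw [norm_real, Real.norm_eq_abs]
    have := abs_le_max_abs_abs hs.1 hs.2
    have := max_le_add_of_nonneg (abs_nonneg a) (abs_nonneg b)
    linarith
  have hΓ := tendsto_squareIntegral (R₁ := |a| + |b| + 1)
    (hcont.mono fun z (hz : _ ≤ ‖z‖) hcut => absurd (hnorm z hcut) hz.not_gt) hinf
  refine tendsto_nhds_unique (tendsto_const_nhds.congr' ?_) hΓ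
  filter_upwards [eventually_ge_atTop (|a| + |b| + 1)] with R hR
  have hR0 : 0 < R := by linarith [abs_nonneg a, abs_nonneg b]
  have haR : -R < a := by linarith [neg_abs_le a, abs_nonneg b]
  have hbR : b < R := by linarith [le_abs_self b, abs_nonneg a]
  -- the two vertical sides do not meet the cut
  have cp : Continuous fun y : ℝ => h (R + y * I) := hcont.comp_continuous (by fun_prop)
    fun y => by simp [mem_cut, hbR]
  have cm : Continuous fun y : ℝ => h (-R + y * I) := hcont.comp_continuous (by fun_prop)
    fun y => by
      simp only [Set.mem_compl_iff, mem_cut]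
      rintro ⟨-, h1, -⟩
      simp at h1
      linarith
  have ch : ∀ y : ℝ, y ≠ 0 → Continuous fun x : ℝ => h (x + y * I) := fun y hy =>
    hcont.comp_continuous (by fun_prop) fun x => by simp [mem_cut, hy]
  -- Cauchy's theorem for the parts of the square above and below the strip `|im z| < ε`
  have hD : ∀ ε ∈ Set.Ioo 0 R, ∫ x in (-R)..R, (h (x - ε * I) - h (x + ε * I)) =
      (∫ x in (-R)..R, h (x - R * I)) - (∫ x in (-R)..R, h (x + R * I)) +
      I * ((∫ y in (-R)..(-ε), h (R + y * I)) + ∫ y in ε..R, h (R + y * I)) -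
      I * ((∫ y in (-R)..(-ε), h (-R + y * I)) + ∫ y in ε..R, h (-R + y * I)) := by
    intro ε hε
    have h1 := integral_rectangle_eq hol R ε R fun y hy => by
      rw [Set.uIcc_of_le hε.2.le] at hy
      exact (hε.1.trans_le hy.1).ne'
    have h2 := integral_rectangle_eq hol R (-R) (-ε) fun y hy => by
      rw [Set.uIcc_of_le (by linarith [hε.2])] at hy
      have := hε.1
      have := hy.2
      intro h0
      linarith
    have c1 := ch (-ε) (by simpa using hε.1.ne')
    have c2 := ch ε hε.1.ne'
    simp only [ofReal_neg, neg_mul, ← sub_eq_add_neg] at h1 h2 c1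
    rw [intervalIntegral.integral_sub (c1.intervalIntegrable _ _) (c2.intervalIntegrable _ _)]
    linear_combination -h1 - h2
  have hlim1 : Tendsto (fun ε : ℝ => ∫ x in (-R)..R, (h (x - ε * I) - h (x + ε * I))) (𝓝[>] 0)
      (𝓝 (squareIntegral h R)) := by
    have prim : ∀ {g : ℝ → ℂ}, Continuous g → Tendsto (fun ε : ℝ =>
        (∫ y in (-R)..(-ε), g y) + ∫ y in ε..R, g y) (𝓝[>] 0) (𝓝 (∫ y in (-R)..R, g y)) := by
      intro g hg
      have hp := fun r => intervalIntegral.continuous_primitive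
        (μ := volume) (fun a b => hg.intervalIntegrable a b) r
      have e : ∀ ε : ℝ, (∫ y in (-R)..(-ε), g y) + ∫ y in ε..R, g y =
          (∫ y in (-R)..(-ε), g y) - ∫ y in R..ε, g y := fun ε => by
        rw [intervalIntegral.integral_symm ε R]; ring
      simp only [e]
      have hcc : Continuous fun ε : ℝ => (∫ y in (-R)..(-ε), g y) - ∫ y in R..ε, g y :=
        ((hp (-R)).comp continuous_neg).sub (hp R)
      have := (hcc.tendsto 0).mono_left (nhdsWithin_le_nhds (s := Set.Ioi 0))
      rw [← intervalIntegral.integral_add_adjacent_intervals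
        (hg.intervalIntegrable (-R) 0) (hg.intervalIntegrable 0 R)]
      simp only [neg_zero] at this
      rwa [intervalIntegral.integral_symm 0 R, sub_neg_eq_add] at this
    refine Tendsto.congr' ?_ ((tendsto_const_nhds.add ((prim cp).const_mul I)).sub
      ((prim cm).const_mul I))
    filter_upwards [Ioo_mem_nhdsGT hR0] with ε hε
    exact (hD ε hε).symm
  -- dominated convergence; outside `[a, b]` the two boundary values agree
  have hlim2 : Tendsto (fun ε : ℝ => ∫ x in (-R)..R, (h (x - ε * I) - h (x + ε * I))) (𝓝[>] 0)
      (𝓝 (∫ x in (-R)..R, (Set.Ioo a b).indicator J x)) := by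
    obtain ⟨B, hB⟩ := bdd (R + R)
    have hb : ∀ ε : ℝ, ε ≠ 0 → |ε| ≤ R → ∀ x ∈ Set.uIoc (-R) R, ‖h (x + ε * I)‖ ≤ B := by
      intro ε h0 hε x hx
      rw [Set.uIoc_of_le (by linarith)] at hx
      refine hB _ (by simp [mem_cut, h0]) ((norm_add_le _ _).trans ?_)
      rw [norm_mul, norm_I, mul_one, norm_real, norm_real, Real.norm_eq_abs, Real.norm_eq_abs]
      have : |x| ≤ R := abs_le.mpr ⟨hx.1.le, hx.2⟩
      linarith
    refine intervalIntegral.tendsto_integral_filter_of_dominated_convergence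
      (fun _ => B + B) ?_ ?_ intervalIntegrable_const ?_
    · filter_upwards [self_mem_nhdsWithin] with ε hε
      have c1 := ch (-ε) (by simpa using (ne_of_gt hε))
      simp only [ofReal_neg, neg_mul, ← sub_eq_add_neg] at c1
      exact (c1.sub (ch ε (ne_of_gt hε))).aestronglyMeasurable
    · filter_upwards [Ioo_mem_nhdsGT hR0] with ε hε
      refine Eventually.of_forall fun x hx => (norm_sub_le _ _).trans (add_le_add ?_ ?_)
      · have := hb (-ε) (by simpa using hε.1.ne') (by
          rw [abs_neg, abs_of_pos hε.1]; exact hε.2.le) x hx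
        simpa only [ofReal_neg, neg_mul, ← sub_eq_add_neg] using this
      · exact hb ε hε.1.ne' (by rw [abs_of_pos hε.1]; exact hε.2.le) x hx
    · have hae : ∀ᵐ s : ℝ, s ∉ ({a, b} : Set ℝ) :=
        measure_eq_zero_iff_ae_notMem.mp ((Set.toFinite _).measure_zero _)
      filter_upwards [hae] with s hs _
      by_cases hsab : s ∈ Set.Ioo a b
      · rw [Set.indicator_of_mem hsab]
        exact jump s hsab
      · rw [Set.indicator_of_notMem hsab]
        have hsc : (s : ℂ) ∈ (cut a b)ᶜ := by
          simp only [Set.mem_compl_iff, mem_cut, ofReal_im, ofReal_re, true_and]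
          simp only [Set.mem_insert_iff, Set.mem_singleton_iff, not_or] at hs
          rintro ⟨h1, h2⟩
          exact hsab ⟨lt_of_le_of_ne h1 (Ne.symm hs.1), lt_of_le_of_ne h2 hs.2⟩
        have hcs : ContinuousAt h s := hcont.continuousAt (hopen.mem_nhds hsc)
        have l1 : Tendsto (fun ε : ℝ => h (s - ε * I)) (𝓝[>] 0) (𝓝 (h s)) := by
          refine hcs.tendsto.comp (Tendsto.mono_left ?_ nhdsWithin_le_nhds)
          have : Continuous fun ε : ℝ => (s : ℂ) - ε * I := by fun_prop
          simpa using this.tendsto 0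
        have l2 : Tendsto (fun ε : ℝ => h (s + ε * I)) (𝓝[>] 0) (𝓝 (h s)) := by
          refine hcs.tendsto.comp (Tendsto.mono_left ?_ nhdsWithin_le_nhds)
          have : Continuous fun ε : ℝ => (s : ℂ) + ε * I := by fun_prop
          simpa using this.tendsto 0
        simpa using l1.sub l2
  rw [tendsto_nhds_unique hlim1 hlim2, intervalIntegral.integral_of_le (by linarith),
    setIntegral_indicator measurableSet_Ioo]
  congr 2
  symm
  refine Set.inter_eq_right.mpr fun s hs => ⟨by linarith [hs.1], by linarith [hs.2]⟩

end ContourIntegrals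

/-! ### Recovering the spectral distribution -/

section SpectralDistribution

open Filter MeasureTheory Complex Polynomial

/-- A series in `1 / x` without constant term behaves like its first term at infinity. -/
lemma tendsto_mul_of_hasSum_laurent {c : ℕ → ℂ} {w : ℂ → ℂ}
    (h : ∀ᶠ x in Bornology.cobounded ℂ, HasSum (fun l : ℕ => c l / x ^ (l + 1)) (w x)) :
    Tendsto (fun x => x * w x) (Bornology.cobounded ℂ) (𝓝 (c 0)) := by
  obtain ⟨x₀, h₀, hx₀⟩ := (h.and (Bornology.eventually_ne_cobounded (0 : ℂ))).exists
  have hlim : ∀ l : ℕ, Tendsto (fun x : ℂ => c l / x ^ l) (Bornology.cobounded ℂ)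
      (𝓝 (if l = 0 then c l else 0)) := by
    intro l
    rcases eq_or_ne l 0 with rfl | hl
    · simp
    · have h1 : Tendsto (fun x : ℂ => c l * (x⁻¹) ^ l) (Bornology.cobounded ℂ)
          (𝓝 (c l * 0 ^ l)) := (tendsto_inv₀_cobounded.pow l).const_mul _
      simpa [hl, div_eq_mul_inv] using h1
  have hsum := tendsto_tsum_of_dominated_convergence
    (bound := fun l => ‖x₀‖ * ‖c l / x₀ ^ (l + 1)‖) (h₀.summable.norm.mul_left _) hlim (by
      filter_upwards [eventually_cobounded_le_norm ‖x₀‖] with x hx l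
      have h0 : 0 < ‖x₀‖ := norm_pos_iff.mpr hx₀
      rw [norm_div, norm_div, norm_pow, norm_pow, pow_succ', ← mul_div_assoc,
        mul_div_mul_left _ _ h0.ne']
      gcongr)
  rw [tsum_ite_eq] at hsum
  refine hsum.congr' ?_
  filter_upwards [h, Bornology.eventually_ne_cobounded (0 : ℂ)] with x hx hx0
  rw [← (hx.mul_left x).tsum_eq]
  refine tsum_congr fun l => ?_
  field_simp
  ring

/-- At infinity, the product of `z` with the polynomially corrected `z ^ l * W z` tends to the
`l`-th coefficient of `W`. -/
lemma tendsto_laurent_tail {m : ℕ → ℝ} {W : ℂ → ℂ}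
    (h : ∀ᶠ x in Bornology.cobounded ℂ, HasSum (fun l : ℕ => (m l : ℂ) / x ^ (l + 1)) (W x))
    (l : ℕ) : Tendsto (fun z => z * (z ^ l * W z - aeval z (momentPoly m (l + 1))))
      (Bornology.cobounded ℂ) (𝓝 (m l : ℂ)) := by
  have := tendsto_mul_of_hasSum_laurent (c := fun k => (m (k + l) : ℂ))
    (w := fun z => z ^ l * W z - aeval z (momentPoly m (l + 1))) (by
      filter_upwards [h, Bornology.eventually_ne_cobounded (0 : ℂ)] with x hx hx0
      exact hasSum_laurent_tail hx0 hx l)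
  simpa using this

namespace Params.IsSpectralDensity

variable {M : Params} {t : ℝ} {W : ℂ → ℂ} {a b : ℝ} {φ : ℝ → ℝ}

lemma exists_boundary_values (hφ : M.IsSpectralDensity t W a b φ) {s : ℝ}
    (hs : s ∈ Set.Ioo a b) : ∃ Wp Wm : ℂ,
      Tendsto (fun ε : ℝ => W (s + ε * I)) (𝓝[>] 0) (𝓝 Wp) ∧
      Tendsto (fun ε : ℝ => W (s - ε * I)) (𝓝[>] 0) (𝓝 Wm) ∧
      Wm - Wp = 2 * Real.pi * I * φ s := by
  obtain ⟨Wp, Wm, hp, hm, h⟩ := hφ.jump s hs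
  refine ⟨Wp, Wm, by simpa only [mul_comm I] using hp, by simpa only [mul_comm I] using hm, ?_⟩
  have : (Real.pi : ℂ) ≠ 0 := ofReal_ne_zero.mpr Real.pi_ne_zero
  rw [h]
  field_simp

lemma tendsto_jump (hφ : M.IsSpectralDensity t W a b φ) {s : ℝ} (hs : s ∈ Set.Ioo a b) :
    Tendsto (fun ε : ℝ => W (s - ε * I) - W (s + ε * I)) (𝓝[>] 0)
      (𝓝 (2 * Real.pi * I * φ s)) := by
  obtain ⟨Wp, Wm, hp, hm, h⟩ := hφ.exists_boundary_values hs
  exact h ▸ hm.sub hp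

lemma nonneg (hφ : M.IsSpectralDensity t W a b φ) (s : ℝ) : 0 ≤ φ s := by
  by_cases hs : s ∈ Set.Ioo a b
  · exact (hφ.pos s hs).le
  · exact (hφ.zero s hs).ge

/-- `φ` is the pointwise limit of the jumps of `W` across strips around `(a, b)`, which are continuous
functions. -/
lemma measurable (hφ : M.IsSpectralDensity t W a b φ) : Measurable φ := by
  have hε : Tendsto (fun n : ℕ => 1 / ((n : ℝ) + 1)) atTop (𝓝[>] 0) :=
    tendsto_nhdsWithin_iff.mpr ⟨tendsto_one_div_add_atTop_nhds_zero_nat,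
      Eventually.of_forall fun n => Set.mem_Ioi.mpr (by positivity)⟩
  have hc : ∀ ε : ℝ, ε ≠ 0 → Continuous fun s : ℝ => W (s + ε * I) := fun ε h =>
    hφ.holomorphic.continuousOn.comp_continuous (by fun_prop) fun s => by simp [mem_cut, h]
  refine measurable_of_tendsto_metrizable (f := fun n : ℕ => (Set.Ioo a b).indicator fun s =>
    ((W (s - (1 / ((n : ℝ) + 1) : ℝ) * I) - W (s + (1 / ((n : ℝ) + 1) : ℝ) * I)) /
      (2 * Real.pi * I)).re) (fun n => ?_) (tendsto_pi_nhds.mpr fun s => ?_)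
  · have hn : 1 / ((n : ℝ) + 1) ≠ 0 := by positivity
    refine Measurable.indicator (Continuous.measurable ?_) measurableSet_Ioo
    have h1 := hc _ hn
    have h2 := hc _ (neg_ne_zero.mpr hn)
    simp only [ofReal_neg, neg_mul, ← sub_eq_add_neg] at h2
    exact continuous_re.comp ((h2.sub h1).div_const _)
  · by_cases hs : s ∈ Set.Ioo a b
    · simp only [Set.indicator_of_mem hs]
      have h1 := ((hφ.tendsto_jump hs).comp hε).div_const (2 * Real.pi * I)
      rw [mul_div_cancel_left₀ _ (by simp [Real.pi_ne_zero])] at h1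
      exact (continuous_re.tendsto _).comp h1
    · simp only [Set.indicator_of_notMem hs, hφ.zero s hs]
      exact tendsto_const_nhds

/-- `φ` is bounded because `W` is bounded near the cut. -/
lemma integrable (ht : 0 < t) (hφ : M.IsSpectralDensity t W a b φ) : Integrable φ := by
  obtain ⟨B, hB⟩ := exists_bound_of_norm_le ht hφ (|a| + |b| + 1)
  have hI : IntegrableOn φ (Set.Ioo a b) := by
    refine Measure.integrableOn_of_bounded (M := (B + B) / (2 * Real.pi)) (by simp)
      hφ.measurable.aestronglyMeasurable ((ae_restrict_iff' measurableSet_Ioo).mpr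
        (Eventually.of_forall fun s hs => ?_))
    have h1 : ‖2 * Real.pi * I * (φ s : ℂ)‖ ≤ B + B := by
      refine le_of_tendsto (hφ.tendsto_jump hs).norm ?_
      filter_upwards [Ioo_mem_nhdsGT zero_lt_one] with ε hε
      have hs' : |s| ≤ |a| + |b| := (abs_le_max_abs_abs hs.1.le hs.2.le).trans
        (max_le_add_of_nonneg (abs_nonneg a) (abs_nonneg b))
      have hn : ‖(s : ℂ)‖ + ‖(ε : ℂ) * I‖ ≤ |a| + |b| + 1 := by
        simp only [norm_mul, norm_real, norm_I, mul_one, Real.norm_eq_abs, abs_of_pos hε.1]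
        linarith [hε.2]
      exact (norm_sub_le _ _).trans (add_le_add
        (hB _ (by simp [mem_cut, hε.1.ne']) ((norm_sub_le _ _).trans hn))
        (hB _ (by simp [mem_cut, hε.1.ne']) ((norm_add_le _ _).trans hn)))
    rw [le_div_iff₀ (by positivity)]
    simp only [norm_mul, norm_real, norm_I, mul_one, norm_ofNat, Real.norm_eq_abs,
      abs_of_pos Real.pi_pos] at h1 ⊢
    linarith
  exact (integrableOn_iff_integrable_of_support_subset fun s hs => by
    by_contra h
    exact hs (hφ.zero s h)).mp hI

lemma isFiniteMeasure (ht : 0 < t) (hφ : M.IsSpectralDensity t W a b φ) :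
    IsFiniteMeasure (spectralMeasure φ) :=
  isFiniteMeasure_withDensity_ofReal (hφ.integrable ht).2

lemma integral_spectralMeasure (hφ : M.IsSpectralDensity t W a b φ) (f : ℝ → ℂ) :
    ∫ s, f s ∂spectralMeasure φ = ∫ s in Set.Ioo a b, (φ s : ℂ) * f s := by
  rw [spectralMeasure, integral_withDensity_eq_integral_toReal_smul
    hφ.measurable.ennreal_ofReal (by simp),
    setIntegral_eq_integral_of_forall_compl_eq_zero fun s hs => by simp [hφ.zero s hs]]
  simp [ENNReal.toReal_ofReal (hφ.nonneg _)]

/-- The moments of the spectral distribution are the coefficients of `W`: the jump of the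
polynomially corrected `z ^ l * W z` is `2πi s ^ l φ(s)`. -/
lemma moment_eq (ht : 0 < t) (hφ : M.IsSpectralDensity t W a b φ) :
    moment (spectralMeasure φ) = M.planarMoment t := by
  funext l
  set p := momentPoly (M.planarMoment t) (l + 1)
  have hp : Differentiable ℂ fun z : ℂ => aeval z p := p.differentiable_aeval
  obtain ⟨hd, hb⟩ : DifferentiableOn ℂ (fun z => z ^ l * W z - aeval z p) (cut a b)ᶜ ∧
      ∀ R, ∃ B, ∀ z ∉ cut a b, ‖z‖ ≤ R → ‖z ^ l * W z - aeval z p‖ ≤ B := by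
    refine ⟨((differentiable_pow l).differentiableOn.mul hφ.holomorphic).sub
      hp.differentiableOn, fun R => ?_⟩
    obtain ⟨B, hB⟩ := exists_bound_of_norm_le ht hφ R
    obtain ⟨B', hB'⟩ := (isCompact_closedBall (0 : ℂ) R).exists_bound_of_continuousOn
      hp.continuous.continuousOn
    refine ⟨R ^ l * B + B', fun z hz hR => (norm_sub_le _ _).trans (add_le_add ?_
      (hB' z (by simpa using hR)))⟩
    rw [norm_mul, norm_pow]
    have := hB z hz hR
    have := (norm_nonneg z).trans hR
    gcongr
  have hj : ∀ s ∈ Set.Ioo a b, Tendsto (fun ε : ℝ =>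
      ((s - ε * I) ^ l * W (s - ε * I) - aeval (s - ε * I) p) -
      ((s + ε * I) ^ l * W (s + ε * I) - aeval (s + ε * I) p)) (𝓝[>] 0)
      (𝓝 (2 * Real.pi * I * (φ s * (s : ℂ) ^ l))) := by
    intro s hs
    obtain ⟨Wp, Wm, h1, h2, h3⟩ := hφ.exists_boundary_values hs
    have e1 : Tendsto (fun ε : ℝ => (s - ε * I : ℂ)) (𝓝[>] 0) (𝓝 s) :=
      ((by fun_prop : Continuous fun ε : ℝ => (s - ε * I : ℂ)).tendsto' 0 _ (by simp)).mono_left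
        nhdsWithin_le_nhds
    have e2 : Tendsto (fun ε : ℝ => (s + ε * I : ℂ)) (𝓝[>] 0) (𝓝 s) :=
      ((by fun_prop : Continuous fun ε : ℝ => (s + ε * I : ℂ)).tendsto' 0 _ (by simp)).mono_left
        nhdsWithin_le_nhds
    have := (((e1.pow l).mul h2).sub ((hp.continuous.tendsto _).comp e1)).sub
      (((e2.pow l).mul h1).sub ((hp.continuous.tendsto _).comp e2))
    have hval : (2 * Real.pi * I * (φ s * (s : ℂ) ^ l)) = (s : ℂ) ^ l * Wm - aeval (s : ℂ) p -
        ((s : ℂ) ^ l * Wp - aeval (s : ℂ) p) := by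
      linear_combination -(s : ℂ) ^ l * h3
    rw [hval]
    exact this
  have h := integral_jump hd hb hj (tendsto_laurent_tail hφ.laurent l)
  rw [integral_const_mul] at h
  have h' := mul_left_cancel₀ (by simp [Real.pi_ne_zero]) h
  rw [← hφ.integral_spectralMeasure fun s => (s : ℂ) ^ l] at h'
  simp only [← ofReal_pow] at h'
  exact ofReal_injective (integral_ofReal.symm.trans h')

/-- `W` is the Stieltjes transform of the spectral distribution: the jump of the difference
quotient of `W` at `x` is `2πi φ(s) / (s - x)`. -/
lemma eq_stieltjes (ht : 0 < t) (hφ : M.IsSpectralDensity t W a b φ) {x : ℂ}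
    (hx : x ∉ cut a b) : W x = stieltjes (spectralMeasure φ) x := by
  have hU : (cut a b)ᶜ ∈ 𝓝 x := (isClosed_cut a b).isOpen_compl.mem_nhds hx
  have hd : DifferentiableOn ℂ (dslope W x) (cut a b)ᶜ :=
    (differentiableOn_dslope hU).mpr hφ.holomorphic
  have hb : ∀ R, ∃ B, ∀ z ∉ cut a b, ‖z‖ ≤ R → ‖dslope W x z‖ ≤ B := by
    intro R
    obtain ⟨B, hB⟩ := exists_bound_of_norm_le ht hφ R
    obtain ⟨δ, hδ, hball⟩ := Metric.nhds_basis_closedBall.mem_iff.mp hU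
    obtain ⟨B', hB'⟩ := (isCompact_closedBall x δ).exists_bound_of_continuousOn
      (hd.continuousOn.mono hball)
    refine ⟨max B' ((B + ‖W x‖) / δ), fun z hz hR => ?_⟩
    by_cases hzx : z ∈ Metric.closedBall x δ
    · exact (hB' z hzx).trans (le_max_left _ _)
    · have hdist : δ < ‖z - x‖ := by simpa [dist_eq_norm] using hzx
      have hne : z ≠ x := by
        rintro rfl
        simp at hdist
        linarith
      refine le_trans ?_ (le_max_right _ _)
      have h1 : ‖W z - W x‖ ≤ B + ‖W x‖ := (norm_sub_le _ _).trans (by gcongr; exact hB z hz hR)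
      rw [dslope_of_ne _ hne, slope_def_field, norm_div]
      gcongr
      exact (norm_nonneg _).trans h1
  -- at infinity `W` vanishes, so `z` times the difference quotient tends to `-W x`
  have hW : Tendsto W (Bornology.cobounded ℂ) (𝓝 0) := by
    have h1 := tendsto_inv₀_cobounded.mul (tendsto_mul_of_hasSum_laurent hφ.laurent)
    rw [zero_mul] at h1
    refine h1.congr' ?_
    filter_upwards [Bornology.eventually_ne_cobounded (0 : ℂ)] with z hz
    rw [inv_mul_cancel_left₀ hz]
  have hinf : Tendsto (fun z => z * dslope W x z) (Bornology.cobounded ℂ) (𝓝 (-W x)) := by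
    have h1 : Tendsto (fun z : ℂ => (1 - x * z⁻¹)⁻¹ * (W z - W x)) (Bornology.cobounded ℂ)
        (𝓝 ((1 - x * 0)⁻¹ * (0 - W x))) :=
      ((tendsto_const_nhds.sub (tendsto_inv₀_cobounded.const_mul x)).inv₀ (by simp)).mul
        (hW.sub_const _)
    simp only [mul_zero, sub_zero, inv_one, one_mul, zero_sub] at h1
    refine h1.congr' ?_
    filter_upwards [Bornology.eventually_ne_cobounded (0 : ℂ), Bornology.eventually_ne_cobounded x] with z h0 hne
    have : z - x ≠ 0 := sub_ne_zero.mpr hne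
    rw [dslope_of_ne _ hne, slope_def_field, show 1 - x * z⁻¹ = (z - x) / z by field_simp]
    field_simp
  have hj : ∀ s ∈ Set.Ioo a b, Tendsto (fun ε : ℝ =>
      dslope W x (s - ε * I) - dslope W x (s + ε * I)) (𝓝[>] 0)
      (𝓝 (-(2 * Real.pi * I) * (φ s * (1 / (x - s))))) := by
    intro s hs
    obtain ⟨Wp, Wm, h1, h2, h3⟩ := hφ.exists_boundary_values hs
    have hsx : (s : ℂ) ≠ x := by
      rintro rfl
      exact hx ⟨s, Set.Ioo_subset_Icc_self hs, rfl⟩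
    have e1 : Tendsto (fun ε : ℝ => (s - ε * I : ℂ)) (𝓝[>] 0) (𝓝 s) :=
      ((by fun_prop : Continuous fun ε : ℝ => (s - ε * I : ℂ)).tendsto' 0 _ (by simp)).mono_left
        nhdsWithin_le_nhds
    have e2 : Tendsto (fun ε : ℝ => (s + ε * I : ℂ)) (𝓝[>] 0) (𝓝 s) :=
      ((by fun_prop : Continuous fun ε : ℝ => (s + ε * I : ℂ)).tendsto' 0 _ (by simp)).mono_left
        nhdsWithin_le_nhds
    have h0 : (s : ℂ) - x ≠ 0 := sub_ne_zero.mpr hsx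
    have h0' : x - s ≠ 0 := sub_ne_zero.mpr hsx.symm
    have := ((h2.sub_const (W x)).div (e1.sub_const x) h0).sub
      ((h1.sub_const (W x)).div (e2.sub_const x) h0)
    have hval : (Wm - W x) / (s - x) - (Wp - W x) / (s - x) =
        -(2 * Real.pi * I) * (φ s * (1 / (x - s))) := by
      rw [← sub_div, div_eq_iff h0, show (s : ℂ) - x = -(x - s) by ring]
      field_simp
      linear_combination h3
    rw [← hval]
    refine this.congr' ?_
    filter_upwards [e1.eventually_ne hsx, e2.eventually_ne hsx] with ε hm hp
    rw [dslope_of_ne _ hm, dslope_of_ne _ hp, slope_def_field, slope_def_field]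
    rfl
  have h := integral_jump hd hb hj hinf
  rw [integral_const_mul, neg_mul, mul_neg, neg_inj] at h
  rw [stieltjes, hφ.integral_spectralMeasure, mul_left_cancel₀ (by simp [Real.pi_ne_zero]) h]

end Params.IsSpectralDensity

end SpectralDistribution

end RandomGeometry

end

theorem mainTheorem5 (M : RandomGeometry.Params) (t : ℝ) (ht : 0 < t)
    (W : ℂ → ℂ) (a b : ℝ) (φ : ℝ → ℝ) (hφ : M.IsSpectralDensity t W a b φ) :
    MeasureTheory.IsFiniteMeasure (RandomGeometry.spectralMeasure φ) ∧
    (∀ x ∉ RandomGeometry.cut a b,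
      W x = RandomGeometry.stieltjes (RandomGeometry.spectralMeasure φ) x) ∧
    ∀ x ∉ RandomGeometry.cut a b,
      RandomGeometry.stieltjes (RandomGeometry.spectralMeasure φ) x ^ 2
        + Polynomial.aeval x
            (M.polyQ t (RandomGeometry.moment (RandomGeometry.spectralMeasure φ)))
          * RandomGeometry.stieltjes (RandomGeometry.spectralMeasure φ) x
        + Polynomial.aeval x
            (M.polyP t (RandomGeometry.moment (RandomGeometry.spectralMeasure φ))) = 0 := by
  have hq := fun x hx => RandomGeometry.quadratic_compl_cut ht hφ (x := x) hx
  rw [hφ.moment_eq ht]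
  refine ⟨hφ.isFiniteMeasure ht, fun x hx => hφ.eq_stieltjes ht hx, fun x hx => ?_⟩
  rw [← hφ.eq_stieltjes ht hx]
  exact hq x hx
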